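/- Let $m\ge 1$ and $\alpha\in(0,1)$ be fixed. A data-generating process (DGP) $\mathbf P$ for sample size $n$ is the joint law of $n$ identically distributed, arbitrarily dependent random vectors $X_1,\dots,X_n\in\mathbb R^m$ with finite mean $\mu_0(\mathbf P)=\mathbf E_{\mathbf P}[X_1]$; write $\mu_{0k}(\mathbf P)$ and $X_{i,k}$ for $k$-th components. Let $\bar X=n^{-1}\sum_{i=1}^n X_i$ and $\hat{\boldsymbol\Sigma}=n^{-1}\sum_{i=1}^n (X_i-\bar X)(X_i-\bar X)'$. Let $R_n\ge 2$ be integers and let $\pi=(\pi_r)_{r=1}^{R_n}$ be i.i.d. uniform draws from the permutations of $\{1,\dots,n\}$, independent of the data $\boldsymbol X=(X_1,\dots,X_n)$. Put $$T_{U,k}(a;\pi)=\frac{1}{\sqrt{mR_n}}\sum_{r=1}^{R_n}(X_{\pi_r(1),k}-a)\,\hat{\boldsymbol\Sigma}_{kk}^{-1}\,(X_{\pi_r(2),k}-a),$$ $$\hat\lambda_k=\bar X_k\hat{\boldsymbol\Sigma}_{kk}^{-1}\frac{1}{\sqrt{mR_n}}\sum_{r=1}^{R_n}\left(X_{\pi_r(1),k}+X_{\pi_r(2),k}\right)-\sqrt{\frac{R_n}{m}}\,\hat{\boldsymbol\Sigma}_{kk}^{-1}\bar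 X_k^2,$$ $$Q_n(\pi)=\max_{1\le k\le m}\left\{T_{U,k}(0;\pi)-\hat\lambda_k\mathbf 1\{\bar X_k<0\}\right\},\qquad \tilde Q_n(\pi)=\max_{1\le k\le m}T_{U,k}(\bar X_k;\pi),$$ where $\hat{\boldsymbol\Sigma}_{kk}^{-1}=1/\hat{\boldsymbol\Sigma}_{kk}$. Let $c_{1-\alpha}$ be the $(1-\alpha)$-quantile of the conditional distribution of $\tilde Q_n(\pi)$ given $\boldsymbol X$, and let $\phi_n=\mathbf 1\{Q_n(\pi)>c_{1-\alpha}\}$. Let $\mathcal P_0$ be a class of DGPs for which there are constants $\delta,L,U\in(0,\infty)$ such that every sequence $\{\mathbf P_n\}_{n\in\mathbb N}\subseteq\mathcal P_0$ (with $\mathbf P_n$ governing the sample of size $n$) satisfies: - $n^{-1/2}\sum_{i=1}^n(X_i-\mu_0(\mathbf P_n))=O_{\mathbf P_n}(1)$; - there is a matrix $\boldsymbol\Sigma$ with $\hat{\boldsymbol\Sigma}\stackrel{p}{\longrightarrow}\boldsymbol\Sigma$, $\max_{i,j}|\boldsymbol\Sigma_{ij}|<U$ and smallest eigenvalue $\lambda_{\min}(\boldsymbol\Sigma)>L$;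 - $n^{-1}\sum_{i=1}^n\|X_i\|^{2+\delta}=O_{\mathbf P_n}(1)$, where $\|\cdot\|$ is the sup norm. Let $\{\mathbf P_n\}_{n\in\mathbb N}\subseteq\mathcal P_0$ be such that, for every $k$, the limit $\delta_k^*=\lim_{n\to\infty}R_n^{1/4}\mu_{0k}(\mathbf P_n)\in\mathbb R\cup\{-\infty,\infty\}$ exists. Suppose $R_n\to\infty$ and $\sqrt{R_n}/n\to 0$. Then: (a) if $\max_k\delta_k^*\le 0$, then $\mathbf E_{\mathbf P_n}[\phi_n]\to\alpha$; (b) if $\max_k\delta_k^*=\infty$, then $\mathbf E_{\mathbf P_n}[\phi_n]\to 1$; (c) if $\max_k\delta_k^*\in(0,\infty)$, then $\mathbf E_{\mathbf P_n}[\phi_n]\to\beta$ for some $\beta>\alpha$. -/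

import Mathlib

open MeasureTheory ProbabilityTheory Filter Topology
open scoped ENNReal

noncomputable section

namespace ResampledTest

/-! ### Data and sample moments -/

/-- A sample of `n` observations in `ℝ^m`; `x i k` is the `k`-th component of the `i`-th observation.
The norm of `Fin m → ℝ` is the sup norm. -/
abbrev Sample (n m : ℕ) : Type := Fin n → Fin m → ℝ

/-- A data-generating process for samples of size `n`: the joint law of `n` identically distributed,
arbitrarily dependent, random vectors with a finite mean. -/
structure DGP (n m : ℕ) where
  /-- the joint law of the observations -/
  law : Measure (Sample n m)
  isProbabilityMeasure : IsProbabilityMeasure law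
  identDistrib : ∀ i j : Fin n, IdentDistrib (fun x : Sample n m => x i) (fun x => x j) law law
  integrable : ∀ i : Fin n, Integrable (fun x : Sample n m => x i) law

attribute [instance] DGP.isProbabilityMeasure

/-- The population mean `μ₀(P) = E_P[X₁]`, component by component
(`0` for the empty sample, which has no first observation). -/
def DGP.mean {n m : ℕ} (P : DGP n m) : Fin m → ℝ :=
  fun k => if h : 0 < n then ∫ x, x ⟨0, h⟩ k ∂P.law else 0

/-- The sample mean. -/
def sampleMean {n m : ℕ} (x : Sample n m) : Fin m → ℝ :=
  fun k => (n : ℝ)⁻¹ * ∑ i, x i k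

/-- The sample variance matrix `n⁻¹ ∑ᵢ (Xᵢ - X̄)(Xᵢ - X̄)'`. -/
def sampleVar {n m : ℕ} (x : Sample n m) : Matrix (Fin m) (Fin m) ℝ :=
  Matrix.of fun k l => (n : ℝ)⁻¹ * ∑ i, (x i k - sampleMean x k) * (x i l - sampleMean x l)

/-! ### Resampling draws -/

instance permMeasurableSpace (n : ℕ) : MeasurableSpace (Equiv.Perm (Fin n)) := ⊤

instance permDiscrete (n : ℕ) : DiscreteMeasurableSpace (Equiv.Perm (Fin n)) :=
  ⟨fun _ => trivial⟩

/-- `R` permutations of the `n` observation indices. -/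
abbrev Draws (n R : ℕ) : Type := Fin R → Equiv.Perm (Fin n)

/-- The law of `R` i.i.d. uniform draws from the permutations of the observation indices. -/
def drawLaw (n R : ℕ) : Measure (Draws n R) :=
  Measure.pi fun _ => (PMF.uniformOfFintype (Equiv.Perm (Fin n))).toMeasure

/-- The observation `X_{σ(j+1)}` (indices are counted from `0` here, so `j = 0` and `j = 1` give
`X_{σ(1)}` and `X_{σ(2)}`); the value `0` is used only if the sample has at most `j` observations. -/
def drawn {n m : ℕ} (x : Sample n m) (σ : Equiv.Perm (Fin n)) (j : ℕ) : Fin m → ℝ :=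
  if h : j < n then x (σ ⟨j, h⟩) else 0

/-! ### The moment inequality test -/

/-- The U-type statistic of the `k`-th component, centred at `a`, with normalization `(m R)^{-1/2}`. -/
def uStat {n m R : ℕ} (x : Sample n m) (π : Draws n R) (k : Fin m) (a : ℝ) : ℝ :=
  (Real.sqrt (m * R))⁻¹ *
    ∑ r, (drawn x (π r) 0 k - a) * (sampleVar x k k)⁻¹ * (drawn x (π r) 1 k - a)

/-- The statistic `λ̂ₖ`. -/
def lambdaHat {n m R : ℕ} (x : Sample n m) (π : Draws n R) (k : Fin m) : ℝ :=
  sampleMean x k * (sampleVar x k k)⁻¹ * (Real.sqrt (m * R))⁻¹ *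
      ∑ r, (drawn x (π r) 0 k + drawn x (π r) 1 k)
    - Real.sqrt (R / m) * (sampleVar x k k)⁻¹ * sampleMean x k ^ 2

/-- The test statistic `Qₙ(π) = maxₖ (T_{U,k}(0; π) - λ̂ₖ 1{X̄ₖ < 0})`. -/
def testStat {n m R : ℕ} (x : Sample n m) (π : Draws n R) : ℝ :=
  ⨆ k : Fin m, (uStat x π k 0 - lambdaHat x π k * (if sampleMean x k < 0 then 1 else 0))

/-- The recentred statistic `Q̃ₙ(π) = maxₖ T_{U,k}(X̄ₖ; π)`. -/
def centredStat {n m R : ℕ} (x : Sample n m) (π : Draws n R) : ℝ :=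
  ⨆ k : Fin m, uStat x π k (sampleMean x k)

/-- The critical value: the `(1 - α)`-quantile of the law of `Q̃ₙ(π)` when the data are held fixed
and only the permutations are random. -/
def critVal {n m : ℕ} (R : ℕ) (α : ℝ) (x : Sample n m) : ℝ :=
  sInf {c : ℝ | 1 - α ≤ (drawLaw n R).real {π | centredStat x π ≤ c}}

/-- The test `φₙ`: `1` if the null is rejected and `0` if it is not. -/
def test {n m R : ℕ} (α : ℝ) (x : Sample n m) (π : Draws n R) : ℝ :=
  if critVal R α x < testStat x π then 1 else 0

/-- The rejection probability `E_P[φₙ]`, the permutations being independent of the data. -/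
def rejectionProb {n m : ℕ} (P : DGP n m) (R : ℕ) (α : ℝ) : ℝ :=
  ∫ ω : Sample n m × Draws n R, test α ω.1 ω.2 ∂(P.law.prod (drawLaw n R))

/-! ### Stochastic order and the regularity conditions -/

/-- `Sₙ = O_{Pₙ}(1)`: boundedness in probability along a sequence of probability spaces. -/
def BoundedInProb {Ω : ℕ → Type*} [∀ n, MeasurableSpace (Ω n)] {E : Type*} [Norm E]
    (μ : ∀ n, Measure (Ω n)) (S : ∀ n, Ω n → E) : Prop :=
  ∀ ε : ℝ, 0 < ε → ∃ M : ℝ, ∀ᶠ n in atTop, (μ n).real {ω | M < ‖S n ω‖} ≤ ε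

/-- Convergence in probability of real random variables to a constant, along a sequence of
probability spaces. -/
def ConvergesInProb {Ω : ℕ → Type*} [∀ n, MeasurableSpace (Ω n)]
    (μ : ∀ n, Measure (Ω n)) (S : ∀ n, Ω n → ℝ) (c : ℝ) : Prop :=
  ∀ ε : ℝ, 0 < ε → Tendsto (fun n => (μ n).real {ω | ε ≤ |S n ω - c|}) atTop (𝓝 0)

/-- The regularity conditions on a sequence of data-generating processes, for given constants:
`√n`-consistency of the sample mean; convergence in probability of the sample variance to a matrix
whose entries are bounded by `U` and whose eigenvalues exceed `L`; and a stochastically bounded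
empirical moment of order `2 + δ`. -/
structure RegularSequence {m : ℕ} (δ L U : ℝ) (P : ∀ n, DGP n m) : Prop where
  rootN : BoundedInProb (fun n => (P n).law)
    (fun n x => fun k => (Real.sqrt n)⁻¹ * ∑ i, (x i k - (P n).mean k))
  variance : ∃ S : Matrix (Fin m) (Fin m) ℝ,
    (∀ k l, ConvergesInProb (fun n => (P n).law) (fun _ x => sampleVar x k l) (S k l)) ∧
    (∀ k l, |S k l| < U) ∧
    ∃ hS : S.IsHermitian, ∀ k, L < hS.eigenvalues k
  moment : BoundedInProb (fun n => (P n).law)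
    (fun n x => (n : ℝ)⁻¹ * ∑ i, ‖x i‖ ^ (2 + δ))

/-- A class of data-generating processes, given by the processes it allows at each sample size, is
regular if, for some positive constants, every sequence in it satisfies the regularity conditions. -/
def RegularClass {m : ℕ} (𝒟 : ∀ n, Set (DGP n m)) : Prop :=
  ∃ δ L U : ℝ, 0 < δ ∧ 0 < L ∧ 0 < U ∧
    ∀ P : ∀ n, DGP n m, (∀ n, P n ∈ 𝒟 n) → RegularSequence δ L U P

end ResampledTest

end

open ResampledTest

noncomputable section

namespace ResampledTest

/-! With the data held fixed, the recentred vector is a normalized sum of `R` i.i.d. terms, one per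
permutation, so its conditional law obeys a Lyapunov central limit theorem. Moments of a term are
averages over ordered pairs of distinct indices (`integral_permLaw_pair`). The mean is of order 1/n,
so √R/n → 0 removes the bias. The cross moments tend to Σ_kl²/(Σ_kk Σ_ll), because the diagonal
pairs are negligible under a 2+δ moment. The moments of order 2+δ are controlled because the two
indices differ. By `RegularArray.tendsto_centredLaw` the limit is a centred Gaussian whose
covariance is 1/m times the entrywise square of the correlation matrix. It is positive definite by
the Schur product theorem, so its joint distribution function G is continuous and strictly
increasing, and the critical value tends to the q with G(q,…,q) = 1 - α.

Algebraically T(0) = T(X̄) + λ̂, so each component of the test statistic is the recentred one plus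
`shift`, which is 0 if X̄ₖ < 0 and λ̂ₖ otherwise (`testStat_eq`). Since √R = (R^{1/4})², the shift
tends to sₖ = Σ_kk⁻¹ m^{-1/2} max(δₖ*, 0)², or diverges if δₖ* = ∞. When all limits are finite the
rejection probability tends to 1 - G(q - s): this is α if s = 0, and exceeds α if some sₖ > 0. A
diverging shift forces rejection.

The randomness of the data is removed by a filter argument. Convergence in probability is
convergence along `probFilter`, which is finer than the countably generated `sampleFilter`.
Sequences therefore suffice, and the problem reduces to deterministic arrays of samples
(`tendsto_rejectionProb`). -/

/-- The uniform law on the permutations of the observation indices. -/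
def permLaw (n : ℕ) : Measure (Equiv.Perm (Fin n)) :=
  (PMF.uniformOfFintype (Equiv.Perm (Fin n))).toMeasure

instance (n : ℕ) : IsProbabilityMeasure (permLaw n) := by unfold permLaw; infer_instance

instance (n R : ℕ) : IsProbabilityMeasure (drawLaw n R) := by
  unfold drawLaw; infer_instance

lemma drawLaw_eq (n R : ℕ) : drawLaw n R = Measure.pi fun _ => permLaw n := rfl

/-! ### Averages over a uniform permutation -/

lemma integral_permLaw {n : ℕ} (f : Equiv.Perm (Fin n) → ℝ) :
    ∫ σ, f σ ∂permLaw n = (Fintype.card (Equiv.Perm (Fin n)) : ℝ)⁻¹ * ∑ σ, f σ := by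
  simp [permLaw, PMF.integral_eq_sum, Finset.mul_sum]

lemma integral_permLaw_mul_right {n : ℕ} (f : Equiv.Perm (Fin n) → ℝ) (τ : Equiv.Perm (Fin n)) :
    ∫ σ, f (σ * τ) ∂permLaw n = ∫ σ, f σ ∂permLaw n := by
  simp only [integral_permLaw]
  congr 1
  exact Equiv.sum_comp (Equiv.mulRight τ) f

/-- Double transitivity of the symmetric group. With invariance of the uniform law under right
multiplication, it gives all ordered pairs of distinct positions the same joint law. -/
lemma exists_perm_pair {ι : Type*} [DecidableEq ι] {a b i j : ι} (hab : a ≠ b) (hij : i ≠ j) :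
    ∃ τ : Equiv.Perm ι, τ a = i ∧ τ b = j := by
  refine ⟨Equiv.swap (Equiv.swap a i b) j * Equiv.swap a i, ?_, by simp⟩
  simp only [Equiv.Perm.mul_apply, Equiv.swap_apply_left]
  refine Equiv.swap_apply_of_ne_of_ne ?_ hij
  intro h
  apply hab
  have := congrArg (Equiv.swap a i) h
  simpa using this

/-- The average of a function of the first two values of a uniform permutation is the average over
pairs of distinct indices. -/
lemma integral_permLaw_pair {n : ℕ} {a b : Fin n} (hab : a ≠ b) (f : Fin n → Fin n → ℝ) :
    (n : ℝ) * (n - 1) * ∫ σ, f (σ a) (σ b) ∂permLaw n = ∑ i, ∑ j, f i j - ∑ i, f i i := by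
  classical
  have key : ∀ i j, i ≠ j →
      ∫ σ, f (σ i) (σ j) ∂permLaw n = ∫ σ, f (σ a) (σ b) ∂permLaw n := by
    intro i j hij
    obtain ⟨τ, h1, h2⟩ := exists_perm_pair hab hij
    rw [← integral_permLaw_mul_right (fun σ => f (σ a) (σ b)) τ]
    simp [h1, h2]
  have h1 : ∀ i, ∑ j, (if i = j then (0 : ℝ) else ∫ σ, f (σ i) (σ j) ∂permLaw n)
      = ((n : ℝ) - 1) * ∫ σ, f (σ a) (σ b) ∂permLaw n := by
    intro i
    have : ∀ j, (if i = j then (0 : ℝ) else ∫ σ, f (σ i) (σ j) ∂permLaw n)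
      = (∫ σ, f (σ a) (σ b) ∂permLaw n) -
        (if i = j then ∫ σ, f (σ a) (σ b) ∂permLaw n else 0) := by
      intro j
      split_ifs with h
      · simp
      · simp [key i j h]
    simp only [this, Finset.sum_sub_distrib]
    simp; ring
  have h2 : ∑ i, ∑ j, (if i = j then (0 : ℝ) else ∫ σ, f (σ i) (σ j) ∂permLaw n)
      = (n : ℝ) * (n - 1) * ∫ σ, f (σ a) (σ b) ∂permLaw n := by
    simp only [h1]; simp; ring
  -- The expectation is spread over all ordered pairs of distinct positions; the resulting sum no
  -- longer depends on the permutation, so averaging it is trivial.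
  rw [← h2]
  have h3 : ∀ σ : Equiv.Perm (Fin n), ∑ i, ∑ j, (if i = j then (0 : ℝ) else f (σ i) (σ j))
      = ∑ i, ∑ j, f i j - ∑ i, f i i := by
    intro σ
    have : ∀ i j, (if i = j then (0 : ℝ) else f (σ i) (σ j))
        = f (σ i) (σ j) - (if i = j then f (σ i) (σ j) else 0) := by
      intro i j; split_ifs <;> simp
    simp only [this, Finset.sum_sub_distrib]
    congr 1
    · rw [Equiv.sum_comp σ (fun i => ∑ j, f i (σ j))]
      exact Finset.sum_congr rfl fun i _ => Equiv.sum_comp σ (f i)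
    · simp only [Finset.sum_ite_eq, Finset.mem_univ, if_true]
      exact Equiv.sum_comp σ (fun i => f i i)
  calc _ = ∫ σ, ∑ i, ∑ j, (if i = j then (0 : ℝ) else f (σ i) (σ j)) ∂permLaw n := by
        rw [integral_finsetSum _ fun i _ => .of_finite]
        refine Finset.sum_congr rfl fun i _ => ?_
        rw [integral_finsetSum _ fun i _ => .of_finite]
        refine Finset.sum_congr rfl fun j _ => ?_
        split_ifs <;> simp
    _ = _ := by simp [h3]

/-! ### Centred observations -/

/-- The observations, centred at the sample mean. -/
def centred {n m : ℕ} (x : Sample n m) : Sample n m := fun i k => x i k - sampleMean x k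

lemma sum_centred {n m : ℕ} (x : Sample n m) (k : Fin m) : ∑ i, centred x i k = 0 := by
  rcases Nat.eq_zero_or_pos n with rfl | hn
  · simp
  · have : (n : ℝ) ≠ 0 := by positivity
    simp [centred, sampleMean, Finset.sum_sub_distrib]
    field_simp; simp

lemma sum_centred_mul {n m : ℕ} (x : Sample n m) (k l : Fin m) :
    ∑ i, centred x i k * centred x i l = n * sampleVar x k l := by
  rcases Nat.eq_zero_or_pos n with rfl | hn
  · simp
  · have : (n : ℝ) ≠ 0 := by positivity
    simp [centred, sampleVar]
    field_simp

lemma sampleVar_self_nonneg {n m : ℕ} (x : Sample n m) (k : Fin m) : 0 ≤ sampleVar x k k := by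
  simp only [sampleVar, Matrix.of_apply]
  exact mul_nonneg (by positivity) (Finset.sum_nonneg fun i _ => mul_self_nonneg _)

/-- The summand of `uStat` at the sample mean. -/
def pairTerm {n m : ℕ} (x : Sample n m) (σ : Equiv.Perm (Fin n)) (k : Fin m) : ℝ :=
  (drawn x σ 0 k - sampleMean x k) * (sampleVar x k k)⁻¹ * (drawn x σ 1 k - sampleMean x k)

lemma pairTerm_eq {n m : ℕ} (hn : 2 ≤ n) (x : Sample n m) (σ : Equiv.Perm (Fin n)) (k : Fin m) :
    pairTerm x σ k = centred x (σ ⟨0, by omega⟩) k * (sampleVar x k k)⁻¹ *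
      centred x (σ ⟨1, by omega⟩) k := by
  simp [pairTerm, drawn, centred, show 0 < n by omega, show 1 < n by omega]

lemma uStat_sampleMean {n m R : ℕ} (x : Sample n m) (π : Draws n R) (k : Fin m) :
    uStat x π k (sampleMean x k) = (Real.sqrt (m * R))⁻¹ * ∑ r, pairTerm x (π r) k := rfl

/-- Centred values sum to zero, so the sum over all pairs vanishes and only minus the diagonal
remains. The product of the variance and its inverse is not simplified because it is 0 for a
degenerate component. -/
lemma integral_pairTerm {n m : ℕ} (hn : 2 ≤ n) (x : Sample n m) (k : Fin m) :
    ((n : ℝ) - 1) * ∫ σ, pairTerm x σ k ∂permLaw n = - (sampleVar x k k * (sampleVar x k k)⁻¹) := by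
  have h := integral_permLaw_pair (n := n) (a := ⟨0, by omega⟩) (b := ⟨1, by omega⟩) (by simp)
    (fun i j => centred x i k * (sampleVar x k k)⁻¹ * centred x j k)
  simp only [pairTerm_eq hn]
  have h1 : ∑ i, ∑ j, centred x i k * (sampleVar x k k)⁻¹ * centred x j k = 0 := by
    simp [← Finset.mul_sum, sum_centred]
  have h2 : ∑ i, centred x i k * (sampleVar x k k)⁻¹ * centred x i k
      = n * sampleVar x k k * (sampleVar x k k)⁻¹ := by
    rw [← sum_centred_mul, Finset.sum_mul]
    exact Finset.sum_congr rfl fun i _ => by ring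
  rw [h1, h2] at h
  have : (n : ℝ) ≠ 0 := by positivity
  apply mul_left_cancel₀ this
  linarith

/-- The full double sum factorizes into a squared covariance; sampling without replacement removes
the diagonal, a fourth-order sum. -/
lemma integral_pairTerm_mul {n m : ℕ} (hn : 2 ≤ n) (x : Sample n m) (k l : Fin m) :
    (n : ℝ) * (n - 1) * ∫ σ, pairTerm x σ k * pairTerm x σ l ∂permLaw n =
      (sampleVar x k k)⁻¹ * (sampleVar x l l)⁻¹ *
        ((n * sampleVar x k l) ^ 2 - ∑ i, (centred x i k * centred x i l) ^ 2) := by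
  have h := integral_permLaw_pair (n := n) (a := ⟨0, by omega⟩) (b := ⟨1, by omega⟩) (by simp)
    (fun i j => (centred x i k * (sampleVar x k k)⁻¹ * centred x j k) *
      (centred x i l * (sampleVar x l l)⁻¹ * centred x j l))
  simp only [pairTerm_eq hn]
  rw [h, mul_sub]
  congr 1
  · rw [← sum_centred_mul, sq, Finset.sum_mul_sum]
    simp only [Finset.mul_sum]
    exact Finset.sum_congr rfl fun i _ => Finset.sum_congr rfl fun j _ => by ring
  · rw [Finset.mul_sum]
    exact Finset.sum_congr rfl fun i _ => by ring

/-- A pair of factors drawn without replacement has at most twice the squared average. -/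
lemma integral_pair_prod_le {n : ℕ} (hn : 2 ≤ n) {a b : Fin n} (hab : a ≠ b) (g : Fin n → ℝ) :
    ∫ σ, g (σ a) * g (σ b) ∂permLaw n ≤ 2 * ((n : ℝ)⁻¹ * ∑ i, g i) ^ 2 := by
  have h := integral_permLaw_pair hab (fun i j => g i * g j)
  have hn' : (2 : ℝ) ≤ n := by exact_mod_cast hn
  rw [← Finset.sum_mul_sum] at h
  have h2 : 0 ≤ ∑ i, g i * g i := Finset.sum_nonneg fun i _ => mul_self_nonneg _
  set S := ∑ i, g i
  set E := ∫ σ, g (σ a) * g (σ b) ∂permLaw n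
  have h3 : (n : ℝ) * (n - 1) * E ≤ S * S := by linarith
  -- The factor 2 bounds n/(n-1) for n ≥ 2.
  have h4 : (n : ℝ) * (n - 1) * (2 * ((n : ℝ)⁻¹ * S) ^ 2) ≥ S * S := by
    have : (n : ℝ) * (n - 1) * (2 * ((n : ℝ)⁻¹ * S) ^ 2) = (2 * (n - 1) / n) * (S * S) := by
      field_simp
    rw [this]
    refine le_mul_of_one_le_left (mul_self_nonneg _) ?_
    rw [le_div_iff₀ (by linarith)]; linarith
  have h5 : 0 < (n : ℝ) * (n - 1) := mul_pos (by linarith) (by linarith)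
  exact le_of_mul_le_mul_left (h3.trans h4) h5

/-- The sum of the two centred draws. -/
def sumTerm {n m : ℕ} (x : Sample n m) (σ : Equiv.Perm (Fin n)) (k : Fin m) : ℝ :=
  drawn x σ 0 k + drawn x σ 1 k - 2 * sampleMean x k

lemma sumTerm_eq {n m : ℕ} (hn : 2 ≤ n) (x : Sample n m) (σ : Equiv.Perm (Fin n)) (k : Fin m) :
    sumTerm x σ k = centred x (σ ⟨0, by omega⟩) k + centred x (σ ⟨1, by omega⟩) k := by
  simp [sumTerm, drawn, centred, show 0 < n by omega, show 1 < n by omega]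
  ring

lemma integral_sumTerm {n m : ℕ} (hn : 2 ≤ n) (x : Sample n m) (k : Fin m) :
    ∫ σ, sumTerm x σ k ∂permLaw n = 0 := by
  have h := integral_permLaw_pair (n := n) (a := ⟨0, by omega⟩) (b := ⟨1, by omega⟩) (by simp)
    (fun i j => centred x i k + centred x j k)
  simp only [sumTerm_eq hn]
  simp only [Finset.sum_add_distrib, sum_centred] at h
  simp [← Finset.mul_sum, sum_centred] at h
  have hn' : (2 : ℝ) ≤ n := by exact_mod_cast hn
  rcases h with (h | h) | h
  · omega
  · linarith
  · exact h

/-- The exact value is 2(n-2)/(n-1) times the variance; a bound by a fixed multiple suffices for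
Chebyshev's inequality. -/
lemma integral_sumTerm_sq_le {n m : ℕ} (hn : 2 ≤ n) (x : Sample n m) (k : Fin m) :
    ∫ σ, sumTerm x σ k ^ 2 ∂permLaw n ≤ 4 * sampleVar x k k := by
  have h := integral_permLaw_pair (n := n) (a := ⟨0, by omega⟩) (b := ⟨1, by omega⟩) (by simp)
    (fun i j => (centred x i k + centred x j k) ^ 2)
  simp only [sumTerm_eq hn]
  have hn' : (2 : ℝ) ≤ n := by exact_mod_cast hn
  have hs : ∑ i, centred x i k ^ 2 = n * sampleVar x k k := by
    rw [← sum_centred_mul]; exact Finset.sum_congr rfl fun i _ => sq _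
  have h1 : ∑ i, ∑ j, (centred x i k + centred x j k) ^ 2 = 2 * n * (n * sampleVar x k k) := by
    simp only [add_sq, Finset.sum_add_distrib, ← Finset.mul_sum, sum_centred, hs]
    simp [← Finset.mul_sum, hs]; ring
  have h2 : ∑ i, (centred x i k + centred x i k) ^ 2 = 4 * (n * sampleVar x k k) := by
    rw [← hs, Finset.mul_sum]; exact Finset.sum_congr rfl fun i _ => by ring
  rw [h1, h2] at h
  have hv := sampleVar_self_nonneg x k
  have h5 : 0 < (n : ℝ) * (n - 1) := mul_pos (by linarith) (by linarith)
  refine le_of_mul_le_mul_left (h.le.trans ?_) h5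
  nlinarith [mul_nonneg (mul_nonneg (by linarith : (0:ℝ) ≤ n) hv) (by linarith : (0:ℝ) ≤ n - 2),
    mul_nonneg (by linarith : (0:ℝ) ≤ n) hv]

/-! ### A central limit theorem for triangular arrays -/

/-- For |u| ≤ 1 the cubic Taylor remainder is at most a multiple of |u|^(2+δ) because δ ≤ 1; for |u|
> 1 every term is dominated by u². -/
lemma norm_exp_mul_I_sub_le {δ : ℝ} (hδ : 0 < δ) (hδ1 : δ ≤ 1) (u : ℝ) :
    ‖Complex.exp (u * Complex.I) - (1 + u * Complex.I - u ^ 2 / 2)‖ ≤ 4 * |u| ^ (2 + δ) := by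
  rcases le_or_gt |u| 1 with hu | hu
  · have h := Complex.exp_bound (x := u * Complex.I) (by simpa using hu) (n := 3) (by norm_num)
    have e : ∑ k ∈ Finset.range 3, (u * Complex.I) ^ k / (k.factorial : ℂ)
        = 1 + u * Complex.I - u ^ 2 / 2 := by
      simp [Finset.sum_range_succ, mul_pow]; ring
    rw [e] at h
    refine h.trans ?_
    have h1 : ‖(u : ℂ) * Complex.I‖ = |u| := by simp
    rw [h1]
    have h2 : |u| ^ 3 ≤ |u| ^ (2 + δ) := by
      rcases eq_or_lt_of_le (abs_nonneg u) with h0 | h0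
      · rw [← h0]; simp; positivity
      · rw [← Real.rpow_natCast]
        exact Real.rpow_le_rpow_of_exponent_ge h0 hu (by push_cast; linarith)
    have h3 : ((3 : ℕ).succ : ℝ) * (((3 : ℕ).factorial : ℝ) * (3 : ℕ))⁻¹ ≤ 4 := by
      norm_num [Nat.factorial]
    calc _ ≤ |u| ^ 3 * 4 := by gcongr
      _ ≤ _ := by linarith
  · have h1 : ‖Complex.exp (u * Complex.I)‖ = 1 := Complex.norm_exp_ofReal_mul_I u
    have h2 : ‖(1 + u * Complex.I - u ^ 2 / 2 : ℂ)‖ ≤ 1 + |u| + |u| ^ 2 / 2 := by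
      refine (norm_sub_le _ _).trans ?_
      refine (add_le_add_left (norm_add_le _ _) _).trans ?_
      simp
    have h3 : |u| ^ 2 ≤ |u| ^ (2 + δ) := by
      rw [← Real.rpow_natCast]
      exact Real.rpow_le_rpow_of_exponent_le hu.le (by push_cast; linarith)
    refine (norm_sub_le _ _).trans ?_
    rw [h1]
    nlinarith

/-- Telescoping in the unit disc: an error o(1/R) in one factor is an error o(1) in the R-th power.
-/
lemma norm_pow_sub_pow_le {a b : ℂ} (ha : ‖a‖ ≤ 1) (hb : ‖b‖ ≤ 1) (n : ℕ) :
    ‖a ^ n - b ^ n‖ ≤ n * ‖a - b‖ := by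
  induction n with
  | zero => simp
  | succ n ih =>
    have : a ^ (n + 1) - b ^ (n + 1) = a * (a ^ n - b ^ n) + (a - b) * b ^ n := by ring
    rw [this]
    refine (norm_add_le _ _).trans ?_
    rw [norm_mul, norm_mul, norm_pow]
    have h1 : ‖a‖ * ‖a ^ n - b ^ n‖ ≤ 1 * (n * ‖a - b‖) := by gcongr
    have h2 : ‖a - b‖ * ‖b‖ ^ n ≤ ‖a - b‖ * 1 := by
      gcongr; exact pow_le_one₀ (norm_nonneg _) hb
    push_cast; linarith

/-- Second order expansion of a characteristic function on a finite probability space. -/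
lemma norm_integral_exp_sub_le {Ω : Type*} [MeasurableSpace Ω] [MeasurableSingletonClass Ω]
    [Finite Ω] (μ : Measure Ω) [IsProbabilityMeasure μ] (ξ : Ω → ℝ) {s δ : ℝ} (hs : 0 ≤ s)
    (hδ : 0 < δ) (hδ1 : δ ≤ 1) :
    ‖∫ ω, Complex.exp ((s * ξ ω : ℝ) * Complex.I) ∂μ
      - (1 + (s * ∫ ω, ξ ω ∂μ : ℝ) * Complex.I - ((s ^ 2 * ∫ ω, ξ ω ^ 2 ∂μ : ℝ) : ℂ) / 2)‖
      ≤ 4 * (s ^ (2 + δ) * ∫ ω, |ξ ω| ^ (2 + δ) ∂μ) := by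
  have e : (1 + (s * ∫ ω, ξ ω ∂μ : ℝ) * Complex.I - ((s ^ 2 * ∫ ω, ξ ω ^ 2 ∂μ : ℝ) : ℂ) / 2)
      = ∫ ω, (1 + (s * ξ ω : ℝ) * Complex.I - ((s * ξ ω : ℝ) : ℂ) ^ 2 / 2) ∂μ := by
    rw [integral_sub .of_finite .of_finite, integral_add .of_finite .of_finite,
      integral_mul_const, integral_div]
    simp only [← Complex.ofReal_pow, mul_pow, integral_complex_ofReal, integral_const_mul]
    simp
  rw [e, ← integral_sub .of_finite .of_finite, ← integral_const_mul, ← integral_const_mul]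
  refine (norm_integral_le_integral_norm _).trans (integral_mono .of_finite .of_finite fun ω => ?_)
  refine (norm_exp_mul_I_sub_le hδ hδ1 (s * ξ ω)).trans ?_
  rw [abs_mul, abs_of_nonneg hs, Real.mul_rpow hs (abs_nonneg _)]

/-- The characteristic functions of normalized sums of i.i.d. rows converge to a Gaussian one. -/
lemma tendsto_integral_exp_pow {Ω : ℕ → Type*} [∀ j, MeasurableSpace (Ω j)]
    [∀ j, MeasurableSingletonClass (Ω j)] [∀ j, Finite (Ω j)] (μ : ∀ j, Measure (Ω j))
    [∀ j, IsProbabilityMeasure (μ j)] (ξ : ∀ j, Ω j → ℝ) (R : ℕ → ℕ) (hR : Tendsto R atTop atTop)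
    {δ v C : ℝ} (hδ : 0 < δ) (hδ1 : δ ≤ 1) (hv : 0 ≤ v)
    (h1 : Tendsto (fun j => √(R j) * ∫ ω, ξ j ω ∂μ j) atTop (𝓝 0))
    (h2 : Tendsto (fun j => ∫ ω, ξ j ω ^ 2 ∂μ j) atTop (𝓝 v))
    (h3 : ∀ᶠ j in atTop, ∫ ω, |ξ j ω| ^ (2 + δ) ∂μ j ≤ C) :
    Tendsto (fun j => (∫ ω, Complex.exp (((√(R j))⁻¹ * ξ j ω : ℝ) * Complex.I) ∂μ j) ^ R j) atTop
      (𝓝 (Complex.exp (-(v / 2 : ℝ)))) := by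
  have hRr : Tendsto (fun j => (R j : ℝ)) atTop atTop := tendsto_natCast_atTop_atTop.comp hR
  -- The four error sources: the bias, the variance error, the Lyapunov remainder, and the
  -- second-order error in expanding the Gaussian factor.
  have hC : Tendsto (fun j => √(R j) * |∫ ω, ξ j ω ∂μ j| + |∫ ω, ξ j ω ^ 2 ∂μ j - v| / 2
      + 4 * ((R j : ℝ) ^ (-(δ / 2)) * |C|) + (v / 2) ^ 2 * (R j : ℝ)⁻¹) atTop (𝓝 0) := by
    have a1 : Tendsto (fun j => √(R j) * |∫ ω, ξ j ω ∂μ j|) atTop (𝓝 0) := by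
      refine h1.abs.congr' (.of_forall fun j => ?_) |>.trans (by simp)
      rw [abs_mul, abs_of_nonneg (Real.sqrt_nonneg _)]
    have a2 : Tendsto (fun j => |∫ ω, ξ j ω ^ 2 ∂μ j - v| / 2) atTop (𝓝 0) := by
      have := (h2.sub_const v).abs.div_const 2
      simpa using this
    have a3 : Tendsto (fun j => (R j : ℝ) ^ (-(δ / 2))) atTop (𝓝 0) :=
      (tendsto_rpow_neg_atTop (by positivity)).comp hRr
    have a4 : Tendsto (fun j => (R j : ℝ)⁻¹) atTop (𝓝 0) := tendsto_inv_atTop_zero.comp hRr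
    have := ((a1.add a2).add ((a3.mul_const |C|).const_mul 4)).add (a4.const_mul ((v / 2) ^ 2))
    simpa using this
  rw [tendsto_iff_norm_sub_tendsto_zero]
  refine squeeze_zero' (.of_forall fun _ => norm_nonneg _) ?_ hC
  filter_upwards [h3, hRr.eventually_ge_atTop 1, hRr.eventually_ge_atTop (v / 2)] with j hj hj1 hjv
  set r : ℝ := (R j : ℝ) with hrdef
  have hr : 0 < r := by linarith
  set φ := ∫ ω, Complex.exp (((√r)⁻¹ * ξ j ω : ℝ) * Complex.I) ∂μ j
  set A := ∫ ω, ξ j ω ∂μ j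
  set B := ∫ ω, ξ j ω ^ 2 ∂μ j
  -- The Gaussian limit is also an R-th power, so the two powers can be compared factor by factor.
  have hpow : Complex.exp (-(v / 2 : ℝ)) = Complex.exp (-(v / 2 / r : ℝ)) ^ R j := by
    rw [← Complex.exp_nat_mul]
    congr 1
    have : (r : ℂ) ≠ 0 := by exact_mod_cast hr.ne'
    push_cast
    rw [show ((R j : ℕ) : ℂ) = (r : ℂ) by simp [hrdef]]
    field_simp
  have hφ : ‖φ‖ ≤ 1 := by
    refine (norm_integral_le_integral_norm _).trans ?_
    simp only [Complex.norm_exp_ofReal_mul_I]; simp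
  have he : ‖Complex.exp (-(v / 2 / r : ℝ))‖ ≤ 1 := by
    rw [← Complex.ofReal_neg, Complex.norm_exp_ofReal, Real.exp_le_one_iff]
    have : 0 ≤ v / 2 / r := by positivity
    linarith
  rw [hpow]
  refine (norm_pow_sub_pow_le hφ he (R j)).trans ?_
  have b1 := norm_integral_exp_sub_le (μ j) (ξ j) (s := (√r)⁻¹) (by positivity) hδ hδ1
  have hs2 : ((√r)⁻¹) ^ 2 = r⁻¹ := by rw [inv_pow, Real.sq_sqrt hr.le]
  have b2 : ‖Complex.exp (-(v / 2 / r : ℝ)) - (1 - (v / 2 / r : ℝ))‖ ≤ (v / 2 / r) ^ 2 := by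
    have : |(-(v / 2 / r))| ≤ 1 := by
      rw [abs_neg, abs_of_nonneg (by positivity), div_le_one hr]; exact hjv
    have := Real.abs_exp_sub_one_sub_id_le this
    rw [← Complex.ofReal_neg, ← Complex.ofReal_exp, ← Complex.ofReal_one, ← Complex.ofReal_sub,
      ← Complex.ofReal_sub, Complex.norm_real, Real.norm_eq_abs]
    rw [show Real.exp (-(v / 2 / r)) - (1 - v / 2 / r) = Real.exp (-(v / 2 / r)) - 1 - -(v / 2 / r)
      by ring]
    exact this.trans_eq (neg_sq _)
  have b3 : ‖(1 + ((√r)⁻¹ * A : ℝ) * Complex.I - ((((√r)⁻¹) ^ 2 * B : ℝ) : ℂ) / 2)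
      - (1 - (v / 2 / r : ℝ))‖ ≤ (√r)⁻¹ * |A| + r⁻¹ * (|B - v| / 2) := by
    have : (1 + ((√r)⁻¹ * A : ℝ) * Complex.I - ((((√r)⁻¹) ^ 2 * B : ℝ) : ℂ) / 2)
      - (1 - (v / 2 / r : ℝ)) = ((√r)⁻¹ * A : ℝ) * Complex.I - ((r⁻¹ * ((B - v) / 2) : ℝ) : ℂ) := by
      rw [hs2]; push_cast; ring
    rw [this]
    refine (norm_sub_le _ _).trans ?_
    rw [norm_mul, Complex.norm_I, mul_one, Complex.norm_real, Complex.norm_real, Real.norm_eq_abs,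
      Real.norm_eq_abs, abs_mul, abs_mul, abs_div, abs_of_pos (inv_pos.2 hr),
      abs_of_pos (inv_pos.2 (Real.sqrt_pos.2 hr))]
    simp
  have b4 : ‖φ - Complex.exp (-(v / 2 / r : ℝ))‖ ≤
      4 * (((√r)⁻¹) ^ (2 + δ) * ∫ ω, |ξ j ω| ^ (2 + δ) ∂μ j)
      + ((√r)⁻¹ * |A| + r⁻¹ * (|B - v| / 2)) + (v / 2 / r) ^ 2 := by
    set z := (1 + ((√r)⁻¹ * A : ℝ) * Complex.I - ((((√r)⁻¹) ^ 2 * B : ℝ) : ℂ) / 2)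
    set w : ℂ := (1 - (v / 2 / r : ℝ))
    have : φ - Complex.exp (-(v / 2 / r : ℝ)) = (φ - z) + (z - w)
      - (Complex.exp (-(v / 2 / r : ℝ)) - w) := by ring
    rw [this]
    exact (norm_sub_le _ _).trans (add_le_add ((norm_add_le _ _).trans (add_le_add b1 b3)) b2)
  have hp : r * ((√r)⁻¹) ^ (2 + δ) = r ^ (-(δ / 2)) := by
    rw [Real.sqrt_eq_rpow, ← Real.rpow_neg hr.le, ← Real.rpow_mul hr.le]
    nth_rw 1 [← Real.rpow_one r]
    rw [← Real.rpow_add hr]; congr 1; ring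
  have hsq : r * (√r)⁻¹ = √r := by
    rw [← div_eq_mul_inv]; exact Real.div_sqrt
  calc r * ‖φ - Complex.exp (-(v / 2 / r : ℝ))‖
      ≤ r * (4 * (((√r)⁻¹) ^ (2 + δ) * |C|)
      + ((√r)⁻¹ * |A| + r⁻¹ * (|B - v| / 2)) + (v / 2 / r) ^ 2) := by
        refine mul_le_mul_of_nonneg_left (b4.trans ?_) hr.le
        gcongr
        exact hj.trans (le_abs_self C)
    _ = 4 * ((r * ((√r)⁻¹) ^ (2 + δ)) * |C|) + ((r * (√r)⁻¹) * |A| + (r * r⁻¹) * (|B - v| / 2))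
      + (v / 2) ^ 2 * r⁻¹ * (r * r⁻¹) := by rw [div_eq_mul_inv (v / 2) r]; ring
    _ = _ := by rw [hp, hsq, mul_inv_cancel₀ hr.ne']; ring

section

/-! ### Moments of the centred observations -/

/-- The empirical absolute moment of order `p`. -/
def absMoment {n m : ℕ} (p : ℝ) (x : Sample n m) : ℝ := (n : ℝ)⁻¹ * ∑ i, ‖x i‖ ^ p

lemma absMoment_nonneg {n m : ℕ} (p : ℝ) (x : Sample n m) : 0 ≤ absMoment p x := by
  unfold absMoment; positivity

/-- Jensen's inequality for the p-th power. -/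
lemma norm_sampleMean_rpow_le {n m : ℕ} (hn : 0 < n) {p : ℝ} (hp : 1 ≤ p) (x : Sample n m) :
    ‖sampleMean x‖ ^ p ≤ absMoment p x := by
  have h1 : ‖sampleMean x‖ ≤ ∑ i, (n : ℝ)⁻¹ * ‖x i‖ := by
    rw [pi_norm_le_iff_of_nonneg (by positivity)]
    intro k
    rw [sampleMean, norm_mul, ← Finset.mul_sum, norm_inv, RCLike.norm_natCast]
    gcongr
    exact (norm_sum_le _ _).trans (Finset.sum_le_sum fun i _ => norm_le_pi_norm (x i) k)
  refine (Real.rpow_le_rpow (norm_nonneg _) h1 (by linarith)).trans ?_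
  rw [absMoment, Finset.mul_sum]
  refine Real.rpow_arith_mean_le_arith_mean_rpow _ _ _ (fun _ _ => by positivity) ?_
    (fun _ _ => norm_nonneg _) hp
  have : (n : ℝ) ≠ 0 := by positivity
  simp [this]

lemma absMoment_centred_le {n m : ℕ} (hn : 0 < n) {p : ℝ} (hp : 1 ≤ p) (x : Sample n m) :
    absMoment p (centred x) ≤ 2 ^ p * (2 * absMoment p x) := by
  have h1 : ∀ i, ‖centred x i‖ ^ p ≤ 2 ^ p * (‖x i‖ ^ p + ‖sampleMean x‖ ^ p) := by
    intro i
    have h2 : ‖centred x i‖ ≤ 2 * max ‖x i‖ ‖sampleMean x‖ := by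
      have : centred x i = x i - sampleMean x := rfl
      rw [this]
      refine (norm_sub_le _ _).trans ?_
      linarith [le_max_left ‖x i‖ ‖sampleMean x‖, le_max_right ‖x i‖ ‖sampleMean x‖]
    refine (Real.rpow_le_rpow (norm_nonneg _) h2 (by linarith)).trans ?_
    rw [Real.mul_rpow (by norm_num) (by positivity)]
    gcongr
    rcases max_cases ‖x i‖ ‖sampleMean x‖ with ⟨h, _⟩ | ⟨h, _⟩ <;> rw [h]
    · linarith [Real.rpow_nonneg (norm_nonneg (sampleMean x)) p]
    · linarith [Real.rpow_nonneg (norm_nonneg (x i)) p]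
  have h3 := norm_sampleMean_rpow_le hn hp x
  have hn' : (n : ℝ) ≠ 0 := by positivity
  calc absMoment p (centred x)
      ≤ (n : ℝ)⁻¹ * ∑ i, 2 ^ p * (‖x i‖ ^ p + ‖sampleMean x‖ ^ p) := by
        unfold absMoment; gcongr with i; exact h1 i
    _ = 2 ^ p * (absMoment p x + ‖sampleMean x‖ ^ p) := by
        rw [← Finset.mul_sum, Finset.sum_add_distrib, absMoment]
        simp; field_simp
    _ ≤ _ := by gcongr; linarith

lemma absMoment_le_one_add {n m : ℕ} {p q : ℝ} (hp : 0 ≤ p) (hpq : p ≤ q) (x : Sample n m) :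
    absMoment p x ≤ 1 + absMoment q x := by
  rcases Nat.eq_zero_or_pos n with rfl | hn
  · simp [absMoment]
  have hn' : (n : ℝ) ≠ 0 := by positivity
  calc absMoment p x ≤ (n : ℝ)⁻¹ * ∑ i, (1 + ‖x i‖ ^ q) := by
        unfold absMoment
        gcongr with i
        rcases le_total ‖x i‖ 1 with h | h
        · have := Real.rpow_le_one (norm_nonneg _) h hp
          linarith [Real.rpow_nonneg (norm_nonneg (x i)) q]
        · linarith [Real.rpow_le_rpow_of_exponent_le h hpq]
    _ = _ := by
        rw [Finset.sum_add_distrib, mul_add, absMoment]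
        simp [hn']

lemma sum_rpow_le_rpow_sum {ι : Type*} (s : Finset ι) (a : ι → ℝ) (ha : ∀ i, 0 ≤ a i) {q : ℝ}
    (hq : 1 ≤ q) : ∑ i ∈ s, a i ^ q ≤ (∑ i ∈ s, a i) ^ q := by
  set S := ∑ i ∈ s, a i
  have hS : 0 ≤ S := Finset.sum_nonneg fun i _ => ha i
  have h1 : ∀ y : ℝ, 0 ≤ y → y ^ q = y * y ^ (q - 1) := by
    intro y hy
    rcases hy.eq_or_lt with h | h
    · rw [← h, Real.zero_rpow (by linarith)]; simp
    · nth_rw 2 [← Real.rpow_one y]; rw [← Real.rpow_add h]; congr 1; ring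
  calc ∑ i ∈ s, a i ^ q ≤ ∑ i ∈ s, a i * S ^ (q - 1) := by
        refine Finset.sum_le_sum fun i hi => ?_
        rw [h1 _ (ha i)]
        exact mul_le_mul_of_nonneg_left (Real.rpow_le_rpow (ha i)
          (Finset.single_le_sum (fun i _ => ha i) hi) (by linarith)) (ha i)
    _ = _ := by rw [← Finset.sum_mul, h1 S hS]

/-- As 4/p ≥ 1, a sum of fourth powers is at most the 4/p-th power of the sum of p-th powers. For p
> 2 the exponent of n is negative, so no fourth moment is required. -/
lemma sum_centred_sq_mul_sq_le {n m : ℕ} (hn : 0 < n) {p : ℝ} (hp0 : 0 < p) (hp : p ≤ 4)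
    (x : Sample n m) (k l : Fin m) :
    ((n : ℝ)⁻¹) ^ 2 * ∑ i, (centred x i k * centred x i l) ^ 2 ≤
      (n : ℝ) ^ (4 / p - 2) * absMoment p (centred x) ^ (4 / p) := by
  have hn' : (0 : ℝ) < n := by positivity
  have h1 : ∑ i, (centred x i k * centred x i l) ^ 2 ≤ (n * absMoment p (centred x)) ^ (4 / p) := by
    have e : (n : ℝ) * absMoment p (centred x) = ∑ i, ‖centred x i‖ ^ p := by
      rw [absMoment]; field_simp
    rw [e]
    refine le_trans ?_ (sum_rpow_le_rpow_sum _ _ (fun i => by positivity)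
      (by rw [le_div_iff₀ hp0]; linarith))
    refine Finset.sum_le_sum fun i _ => ?_
    rw [← Real.rpow_mul (norm_nonneg _), mul_div_cancel₀ _ hp0.ne']
    have h2 := norm_le_pi_norm (centred x i) k
    have h3 := norm_le_pi_norm (centred x i) l
    have : (centred x i k * centred x i l) ^ 2 = (‖centred x i k‖ * ‖centred x i l‖) ^ 2 := by
      simp [mul_pow]
    rw [this, show (4 : ℝ) = ((4 : ℕ) : ℝ) by norm_num, Real.rpow_natCast]
    calc (‖centred x i k‖ * ‖centred x i l‖) ^ 2
        ≤ (‖centred x i‖ * ‖centred x i‖) ^ 2 := by gcongr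
      _ = _ := by ring
  rw [Real.mul_rpow hn'.le (absMoment_nonneg _ _)] at h1
  have e2 : (n : ℝ) ^ (4 / p - 2) = ((n : ℝ)⁻¹) ^ 2 * (n : ℝ) ^ (4 / p) := by
    rw [Real.rpow_sub hn', show (2 : ℝ) = ((2 : ℕ) : ℝ) by norm_num, Real.rpow_natCast]
    field_simp
  rw [e2, mul_assoc]
  gcongr

/-! ### Regular arrays of samples -/

/-- An array of (non-random) samples whose sizes grow, whose variance matrices converge and whose
moments of order `2 + δ` are bounded. -/
structure RegularArray {m : ℕ} (δ M : ℝ) (S : Matrix (Fin m) (Fin m) ℝ) (N : ℕ → ℕ)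
    (x : ∀ j, Sample (N j) m) : Prop where
  size : Tendsto N atTop atTop
  var : ∀ k l, Tendsto (fun j => sampleVar (x j) k l) atTop (𝓝 (S k l))
  moment : ∀ᶠ j in atTop, absMoment (2 + δ) (x j) ≤ M

variable {m : ℕ} {δ M : ℝ} {S : Matrix (Fin m) (Fin m) ℝ} {N R : ℕ → ℕ} {x : ∀ j, Sample (N j) m}

/-- Allows δ ≤ 1, which the Taylor bound on the exponential requires. -/
lemma RegularArray.mono_exponent (h : RegularArray δ M S N x) {δ' : ℝ} (h0 : 0 ≤ δ') (hd : δ' ≤ δ) :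
    RegularArray δ' (1 + M) S N x where
  size := h.size
  var := h.var
  moment := h.moment.mono fun j hj =>
    (absMoment_le_one_add (by linarith) (by linarith : 2 + δ' ≤ 2 + δ) (x j)).trans (by linarith)

lemma RegularArray.tendsto_size (h : RegularArray δ M S N x) :
    Tendsto (fun j => (N j : ℝ)) atTop atTop := tendsto_natCast_atTop_atTop.comp h.size

/-- The asymptotic variance matrix of the vector of recentred statistics, up to the factor `1/m`. -/
def squaredCorr (S : Matrix (Fin m) (Fin m) ℝ) : Matrix (Fin m) (Fin m) ℝ :=
  Matrix.of fun k l => (S k k)⁻¹ * (S l l)⁻¹ * S k l ^ 2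

lemma RegularArray.tendsto_ratio (h : RegularArray δ M S N x) :
    Tendsto (fun j => (N j : ℝ) / (N j - 1)) atTop (𝓝 1) := by
  have h1 : Tendsto (fun j => (1 - (N j : ℝ)⁻¹)⁻¹) atTop (𝓝 1) := by
    have := (tendsto_inv_atTop_zero.comp h.tendsto_size).const_sub 1
    simpa using this.inv₀ (by simp)
  refine h1.congr' ?_
  filter_upwards [h.tendsto_size.eventually_gt_atTop 1] with j hj
  have : (N j : ℝ) ≠ 0 := by linarith
  have : (N j : ℝ) - 1 ≠ 0 := by linarith
  field_simp

lemma RegularArray.tendsto_fourth (hδ : 0 < δ) (hδ1 : δ ≤ 1) (h : RegularArray δ M S N x)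
    (k l : Fin m) : Tendsto (fun j => ((N j : ℝ)⁻¹) ^ 2 *
      ∑ i, (centred (x j) i k * centred (x j) i l) ^ 2) atTop (𝓝 0) := by
  have h0 : Tendsto (fun j => (N j : ℝ) ^ (4 / (2 + δ) - 2)) atTop (𝓝 0) := by
    have hneg : 0 < 2 - 4 / (2 + δ) := by
      rw [sub_pos, div_lt_iff₀ (by linarith)]; linarith
    have := (tendsto_rpow_neg_atTop hneg).comp h.tendsto_size
    refine this.congr fun j => ?_
    simp only [Function.comp]; congr 1; ring
  have h1 := h0.mul_const ((2 ^ (2 + δ) * (2 * M)) ^ (4 / (2 + δ)))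
  rw [zero_mul] at h1
  refine squeeze_zero' (.of_forall fun j => by positivity) ?_ h1
  filter_upwards [h.moment, h.size.eventually_gt_atTop 0] with j hj hj0
  refine (sum_centred_sq_mul_sq_le hj0 (by linarith : 0 < 2 + δ) (by linarith) (x j) k l).trans ?_
  gcongr
  · exact absMoment_nonneg _ _
  · exact (absMoment_centred_le hj0 (by linarith) (x j)).trans (by gcongr)

lemma RegularArray.tendsto_integral_pairTerm_mul (hδ : 0 < δ) (hδ1 : δ ≤ 1)
    (h : RegularArray δ M S N x) (hS : ∀ k, S k k ≠ 0) (k l : Fin m) :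
    Tendsto (fun j => ∫ σ, pairTerm (x j) σ k * pairTerm (x j) σ l ∂permLaw (N j)) atTop
      (𝓝 (squaredCorr S k l)) := by
  have h1 : Tendsto (fun j => (sampleVar (x j) k k)⁻¹ * (sampleVar (x j) l l)⁻¹ *
      ((N j : ℝ) / (N j - 1) * (sampleVar (x j) k l ^ 2 - ((N j : ℝ)⁻¹) ^ 2 *
        ∑ i, (centred (x j) i k * centred (x j) i l) ^ 2))) atTop (𝓝 (squaredCorr S k l)) := by
    have := (((h.var k k).inv₀ (hS k)).mul ((h.var l l).inv₀ (hS l))).mul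
      (h.tendsto_ratio.mul (((h.var k l).pow 2).sub (h.tendsto_fourth hδ hδ1 k l)))
    simpa [squaredCorr] using this
  refine h1.congr' ?_
  filter_upwards [h.size.eventually_ge_atTop 2] with j hj
  have hj' : (2 : ℝ) ≤ N j := by exact_mod_cast hj
  have e := integral_pairTerm_mul hj (x j) k l
  have hn1 : (N j : ℝ) - 1 ≠ 0 := by linarith
  have hn0 : (N j : ℝ) ≠ 0 := by linarith
  have h5 : (N j : ℝ) * (N j - 1) ≠ 0 := mul_ne_zero hn0 hn1
  apply mul_left_cancel₀ h5
  rw [e]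
  generalize (∑ i, (centred (x j) i k * centred (x j) i l) ^ 2) = T
  generalize (sampleVar (x j) k k)⁻¹ * (sampleVar (x j) l l)⁻¹ = U
  field_simp

/-- The bias of a pair drawn without replacement is at most 1/(n-1) in absolute value, which √R/n →
0 makes negligible after scaling by √R. -/
lemma RegularArray.tendsto_integral_pairTerm (h : RegularArray δ M S N x)
    (hR : Tendsto (fun j => √(R j) / (N j : ℝ)) atTop (𝓝 0)) (k : Fin m) :
    Tendsto (fun j => √(R j) * ∫ σ, pairTerm (x j) σ k ∂permLaw (N j)) atTop (𝓝 0) := by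
  rw [tendsto_zero_iff_abs_tendsto_zero]
  have h1 := hR.mul h.tendsto_ratio
  rw [zero_mul] at h1
  refine squeeze_zero' (.of_forall fun _ => abs_nonneg _) ?_ h1
  filter_upwards [h.size.eventually_ge_atTop 2] with j hj
  have hj' : (2 : ℝ) ≤ N j := by exact_mod_cast hj
  have e := integral_pairTerm hj (x j) k
  have hn1 : 0 < (N j : ℝ) - 1 := by linarith
  have hb : |sampleVar (x j) k k * (sampleVar (x j) k k)⁻¹| ≤ 1 := by
    rcases eq_or_ne (sampleVar (x j) k k) 0 with h0 | h0
    · simp [h0]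
    · simp [mul_inv_cancel₀ h0]
  have e2 : ∫ σ, pairTerm (x j) σ k ∂permLaw (N j)
      = -(sampleVar (x j) k k * (sampleVar (x j) k k)⁻¹) / (N j - 1) := by
    rw [← e]; field_simp
  simp only [Function.comp]
  rw [e2, abs_mul, abs_div, abs_neg, abs_of_pos hn1, abs_of_nonneg (Real.sqrt_nonneg _)]
  calc _ ≤ √(R j) * (1 / (N j - 1)) := by gcongr
    _ = _ := by
      have : (N j : ℝ) ≠ 0 := by linarith
      field_simp

lemma abs_sum_mul_pairTerm_le {n m : ℕ} (hn : 2 ≤ n) (x : Sample n m) (t : Fin m → ℝ)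
    (σ : Equiv.Perm (Fin n)) :
    |∑ k, t k * pairTerm x σ k| ≤ (∑ k, |t k| * |(sampleVar x k k)⁻¹|) *
      (‖centred x (σ ⟨0, by omega⟩)‖ * ‖centred x (σ ⟨1, by omega⟩)‖) := by
  refine (Finset.abs_sum_le_sum_abs _ _).trans ?_
  rw [Finset.sum_mul]
  refine Finset.sum_le_sum fun k _ => ?_
  rw [pairTerm_eq hn, abs_mul, abs_mul, abs_mul]
  have h1 := norm_le_pi_norm (centred x (σ ⟨0, by omega⟩)) k
  have h2 := norm_le_pi_norm (centred x (σ ⟨1, by omega⟩)) k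
  simp only [Real.norm_eq_abs] at h1 h2
  calc _ = |t k| * |(sampleVar x k k)⁻¹| * (|centred x (σ ⟨0, by omega⟩) k| *
        |centred x (σ ⟨1, by omega⟩) k|) := by ring
    _ ≤ _ := by gcongr

/-- The Lyapunov moment. The two factors have distinct indices, so the p-th moment of their product
is controlled by the square of a p-th moment, not by a moment of order 2p. -/
lemma integral_abs_sum_mul_pairTerm_rpow_le {n m : ℕ} (hn : 2 ≤ n) (x : Sample n m) (t : Fin m → ℝ)
    {p : ℝ} (hp : 1 ≤ p) :
    ∫ σ, |∑ k, t k * pairTerm x σ k| ^ p ∂permLaw n ≤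
      (∑ k, |t k| * |(sampleVar x k k)⁻¹|) ^ p * (2 * (2 ^ p * (2 * absMoment p x)) ^ 2) := by
  have hc : 0 ≤ ∑ k, |t k| * |(sampleVar x k k)⁻¹| :=
    Finset.sum_nonneg fun k _ => by positivity
  have h1 : ∫ σ, |∑ k, t k * pairTerm x σ k| ^ p ∂permLaw n ≤
      ∫ σ, (∑ k, |t k| * |(sampleVar x k k)⁻¹|) ^ p *
        (‖centred x (σ ⟨0, by omega⟩)‖ ^ p * ‖centred x (σ ⟨1, by omega⟩)‖ ^ p) ∂permLaw n := by
    refine integral_mono .of_finite .of_finite fun σ => ?_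
    refine (Real.rpow_le_rpow (abs_nonneg _) (abs_sum_mul_pairTerm_le hn x t σ)
      (by linarith)).trans_eq ?_
    rw [Real.mul_rpow hc (by positivity), Real.mul_rpow (norm_nonneg _) (norm_nonneg _)]
  refine h1.trans ?_
  rw [integral_const_mul]
  gcongr
  refine (integral_pair_prod_le hn (by simp) (fun i => ‖centred x i‖ ^ p)).trans ?_
  have := absMoment_centred_le (by omega : 0 < n) hp x
  have h0 := absMoment_nonneg p (centred x)
  unfold absMoment at this h0 ⊢
  gcongr

end

section

/-! ### Weak convergence of the recentred statistics -/

instance (n R : ℕ) : MeasurableSingletonClass (Draws n R) := by unfold Draws; infer_instance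

/-- The vector of recentred statistics. -/
def centredVec {n m R : ℕ} (x : Sample n m) (π : Draws n R) : EuclideanSpace ℝ (Fin m) :=
  WithLp.toLp 2 fun k => uStat x π k (sampleMean x k)

/-- The law of the recentred statistics when the data are held fixed. -/
def centredLaw {n m : ℕ} (R : ℕ) (x : Sample n m) : ProbabilityMeasure (EuclideanSpace ℝ (Fin m)) :=
  ⟨(drawLaw n R).map (centredVec x),
    Measure.isProbabilityMeasure_map (measurable_of_finite _).aemeasurable⟩

lemma centredLaw_apply {n m R : ℕ} (x : Sample n m) {A : Set (EuclideanSpace ℝ (Fin m))}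
    (hA : MeasurableSet A) :
    (centredLaw R x : Measure (EuclideanSpace ℝ (Fin m))).real A
      = (drawLaw n R).real {π | centredVec x π ∈ A} :=
  map_measureReal_apply (measurable_of_finite _) hA

/-- Independence of the draws turns the characteristic function into an R-th power, reducing the
vector limit to scalar linear combinations. -/
lemma charFun_centredLaw {n m R : ℕ} (x : Sample n m) (t : EuclideanSpace ℝ (Fin m)) :
    charFun (centredLaw R x : Measure (EuclideanSpace ℝ (Fin m))) t =
      (∫ σ, Complex.exp (((√R)⁻¹ * ∑ k, ((√m)⁻¹ * t k) * pairTerm x σ k : ℝ) * Complex.I)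
        ∂permLaw n) ^ R := by
  have e := integral_fintype_prod_eq_pow (ι := Fin R) (μ := permLaw n) (fun σ =>
    Complex.exp (((√R)⁻¹ * ∑ k, ((√m)⁻¹ * t k) * pairTerm x σ k : ℝ) * Complex.I))
  rw [Fintype.card_fin] at e
  rw [← e, charFun_apply]
  change ∫ w, _ ∂((drawLaw n R).map (centredVec x)) = _
  rw [integral_map (measurable_of_finite _).aemeasurable (by fun_prop), drawLaw_eq]
  congr 1 with π
  rw [← Complex.exp_sum, ← Finset.sum_mul, ← Complex.ofReal_sum]
  congr 3
  simp only [PiLp.inner_apply, centredVec, uStat_sampleMean, Real.inner_apply, Finset.mul_sum,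
    Finset.sum_mul]
  rw [Finset.sum_comm]
  refine Finset.sum_congr rfl fun r _ => Finset.sum_congr rfl fun k _ => ?_
  rw [Real.sqrt_mul (Nat.cast_nonneg m), mul_inv]
  ring

/-- Schur product theorem for S ∘ S, followed by congruence with an invertible diagonal matrix. -/
lemma posDef_squaredCorr {m : ℕ} {S : Matrix (Fin m) (Fin m) ℝ} (hS : S.PosDef) :
    (squaredCorr S).PosDef := by
  have h1 := hS.hadamard hS
  have h2 : squaredCorr S = (Matrix.diagonal fun k => (S k k)⁻¹).conjTranspose *
      (S.hadamard S) * (Matrix.diagonal fun k => (S k k)⁻¹) := by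
    ext k l
    rw [Matrix.diagonal_conjTranspose, Matrix.mul_diagonal, Matrix.diagonal_mul]
    simp [squaredCorr]; ring
  rw [h2]
  refine h1.conjTranspose_mul_mul_same ?_
  rw [Matrix.mulVec_injective_iff_isUnit, Matrix.isUnit_diagonal, Pi.isUnit_iff]
  exact fun k => (inv_ne_zero hS.diag_pos.ne').isUnit

/-- The asymptotic variance matrix of the vector of recentred statistics. -/
def limitVar {m : ℕ} (S : Matrix (Fin m) (Fin m) ℝ) : Matrix (Fin m) (Fin m) ℝ :=
  (m : ℝ)⁻¹ • squaredCorr S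

lemma posDef_limitVar {m : ℕ} (hm : 0 < m) {S : Matrix (Fin m) (Fin m) ℝ} (hS : S.PosDef) :
    (limitVar S).PosDef :=
  (posDef_squaredCorr hS).smul (by positivity)

/-- The asymptotic law of the vector of recentred statistics. -/
def limitLaw {m : ℕ} (S : Matrix (Fin m) (Fin m) ℝ) :
    ProbabilityMeasure (EuclideanSpace ℝ (Fin m)) :=
  ⟨multivariateGaussian 0 (limitVar S), inferInstance⟩

variable {m : ℕ} {δ M : ℝ} {S : Matrix (Fin m) (Fin m) ℝ} {N R : ℕ → ℕ} {x : ∀ j, Sample (N j) m}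

/-- Lévy's continuity theorem: for each t the scalar limit theorem applies to the combination of
pair terms with weights tₖ/√m. -/
lemma RegularArray.tendsto_centredLaw (hm : 0 < m) (hδ : 0 < δ) (hδ1 : δ ≤ 1)
    (h : RegularArray δ M S N x) (hS : S.PosDef) (hR : Tendsto R atTop atTop)
    (hRN : Tendsto (fun j => √(R j) / (N j : ℝ)) atTop (𝓝 0)) :
    Tendsto (fun j => centredLaw (R j) (x j)) atTop (𝓝 (limitLaw S)) := by
  have hSk : ∀ k, S k k ≠ 0 := fun k => hS.diag_pos.ne'
  refine ProbabilityMeasure.tendsto_of_tendsto_charFun fun t => ?_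
  simp only [charFun_centredLaw]
  have hV := posDef_limitVar hm hS
  have e : charFun (limitLaw S : Measure (EuclideanSpace ℝ (Fin m))) t =
      Complex.exp (-((∑ k, ∑ l, ((√m)⁻¹ * t k) * ((√m)⁻¹ * t l) * squaredCorr S k l) / 2 : ℝ)) := by
    change charFun (multivariateGaussian 0 (limitVar S)) t = _
    rw [charFun_multivariateGaussian hV.posSemidef]
    simp only [inner_zero_right, Complex.ofReal_zero, zero_mul, zero_sub]
    congr 2
    rw [Complex.ofReal_div]
    congr 2
    simp only [dotProduct, Matrix.mulVec, limitVar, Matrix.smul_apply, Finset.mul_sum, smul_eq_mul]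
    refine Finset.sum_congr rfl fun k _ => Finset.sum_congr rfl fun l _ => ?_
    have : (m : ℝ)⁻¹ = (√m)⁻¹ * (√m)⁻¹ := by
      rw [← mul_inv, Real.mul_self_sqrt (Nat.cast_nonneg m)]
    rw [this]; ring
  have hv : 0 ≤ ∑ k, ∑ l, ((√m)⁻¹ * t k) * ((√m)⁻¹ * t l) * squaredCorr S k l := by
    have := (posDef_squaredCorr hS).posSemidef.dotProduct_mulVec_nonneg (fun k => (√m)⁻¹ * t k)
    refine this.trans_eq ?_
    simp only [dotProduct, Matrix.mulVec, Finset.mul_sum, Pi.star_apply, star_trivial]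
    exact Finset.sum_congr rfl fun k _ => Finset.sum_congr rfl fun l _ => by ring
  rw [e]
  have hc : Tendsto (fun j => (∑ k, |(√m)⁻¹ * t k| * |(sampleVar (x j) k k)⁻¹|)) atTop
      (𝓝 (∑ k, |(√m)⁻¹ * t k| * |(S k k)⁻¹|)) :=
    tendsto_finsetSum _ fun k _ => ((h.var k k).inv₀ (hSk k)).abs.const_mul _
  refine tendsto_integral_exp_pow (fun j => permLaw (N j))
    (fun j σ => ∑ k, ((√m)⁻¹ * t k) * pairTerm (x j) σ k) R hR hδ hδ1 hv ?_ ?_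
    -- The added 1 is slack: the coefficients with sample variances are eventually below their limit
    -- plus 1.
    (C := (∑ k, |(√m)⁻¹ * t k| * |(S k k)⁻¹| + 1) ^ (2 + δ) *
      (2 * (2 ^ (2 + δ) * (2 * M)) ^ 2)) ?_
  · have := tendsto_finsetSum Finset.univ fun k (_ : k ∈ Finset.univ) =>
      (h.tendsto_integral_pairTerm hRN k).const_mul ((√m)⁻¹ * t k)
    simp only [mul_zero, Finset.sum_const_zero] at this
    refine this.congr fun j => ?_
    rw [integral_finsetSum _ fun k _ => .of_finite, Finset.mul_sum]
    refine Finset.sum_congr rfl fun k _ => ?_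
    rw [integral_const_mul]; ring
  · have := tendsto_finsetSum Finset.univ fun k (_ : k ∈ Finset.univ) =>
      tendsto_finsetSum Finset.univ fun l (_ : l ∈ Finset.univ) =>
        (h.tendsto_integral_pairTerm_mul hδ hδ1 hSk k l).const_mul
          (((√m)⁻¹ * t k) * ((√m)⁻¹ * t l))
    refine this.congr fun j => ?_
    simp only [sq, Finset.sum_mul_sum]
    rw [integral_finsetSum _ fun k _ => .of_finite]
    refine Finset.sum_congr rfl fun k _ => ?_
    rw [integral_finsetSum _ fun k _ => .of_finite]
    refine Finset.sum_congr rfl fun l _ => ?_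
    rw [← integral_const_mul]
    congr 1 with σ; ring
  · filter_upwards [h.moment, h.size.eventually_ge_atTop 2,
      hc.eventually_le_const (lt_add_one _)] with j hj hj2 hjc
    refine (integral_abs_sum_mul_pairTerm_rpow_le hj2 (x j) _ (by linarith)).trans ?_
    have := absMoment_nonneg (2 + δ) (x j)
    gcongr

/-! ### The asymptotic law -/

instance {m : ℕ} : Measure.IsOpenPosMeasure (stdGaussian (EuclideanSpace ℝ (Fin m))) := by
  rw [← map_pi_eq_stdGaussian]
  have : Measure.IsOpenPosMeasure (gaussianReal 0 1) :=
    (gaussianReal_absolutelyContinuous' 0 one_ne_zero).isOpenPosMeasure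
  exact (PiLp.continuous_toLp 2 _).isOpenPosMeasure_map (WithLp.toLp_surjective 2)

open scoped MatrixOrder in
-- Image of a measure with full support under the square root of V, which is onto because V is
-- invertible. Full support makes the limiting distribution function strictly increasing.
lemma isOpenPosMeasure_multivariateGaussian {m : ℕ} {V : Matrix (Fin m) (Fin m) ℝ} (hV : V.PosDef) :
    Measure.IsOpenPosMeasure (multivariateGaussian 0 V) := by
  unfold multivariateGaussian
  refine Continuous.isOpenPosMeasure_map (by fun_prop) ?_
  have h1 : CFC.sqrt V * CFC.sqrt V = V := CFC.sqrt_mul_sqrt_self _ hV.posSemidef.nonneg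
  have h2 : IsUnit (CFC.sqrt V) := by
    have := hV.isUnit
    rw [← h1] at this
    exact isUnit_of_mul_isUnit_left this
  have h3 := h2.map (Matrix.toEuclideanCLM (n := Fin m) (𝕜 := ℝ))
  obtain ⟨u, hu⟩ := h3
  intro y
  refine ⟨(↑u⁻¹ : EuclideanSpace ℝ (Fin m) →L[ℝ] EuclideanSpace ℝ (Fin m)) y, ?_⟩
  simp only [zero_add]
  rw [← hu, ← mul_apply_eq_comp, Units.mul_inv, one_apply_eq_self]

instance {m : ℕ} (S : Matrix (Fin m) (Fin m) ℝ) :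
    IsProbabilityMeasure (limitLaw S : Measure (EuclideanSpace ℝ (Fin m))) :=
  (limitLaw S).2

lemma limitLaw_eval_eq (hm : 0 < m) (hS : S.PosDef) (k : Fin m) (a : ℝ) :
    (limitLaw S : Measure (EuclideanSpace ℝ (Fin m))) {w | w k = a} = 0 := by
  have hV := posDef_limitVar hm hS
  have h1 := measurePreserving_eval_multivariateGaussian (μ := 0) hV.posSemidef (i := k)
  have hne : (limitVar S k k).toNNReal ≠ 0 := by
    simpa using hV.diag_pos
  have := nullSingletonClass_gaussianReal (μ := (0 : EuclideanSpace ℝ (Fin m)) k) hne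
  have h2 := h1.measure_preimage (s := {a}) (measurableSet_singleton a).nullMeasurableSet
  rw [measure_singleton] at h2
  exact h2

/-- The joint distribution function of the asymptotic law. -/
def limitCdf (S : Matrix (Fin m) (Fin m) ℝ) (a : Fin m → ℝ) : ℝ :=
  (limitLaw S : Measure (EuclideanSpace ℝ (Fin m))).real {w | ∀ k, w k ≤ a k}

lemma measurableSet_orthant (a : Fin m → ℝ) :
    MeasurableSet {w : EuclideanSpace ℝ (Fin m) | ∀ k, w k ≤ a k} := by
  rw [Set.ofPred_forall]
  exact MeasurableSet.iInter fun k => measurableSet_le (by fun_prop) (by fun_prop)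

/-- The boundary of an orthant lies in finitely many coordinate hyperplanes, which are null; off
them the indicators converge. -/
lemma continuous_limitCdf (hm : 0 < m) (hS : S.PosDef) : Continuous (limitCdf S) := by
  refine continuous_iff_continuousAt.2 fun a => ?_
  refine (ENNReal.tendsto_toReal (measure_ne_top _ _)).comp ?_
  refine tendsto_measure_of_ae_tendsto_indicator_of_isFiniteMeasure _ (measurableSet_orthant a)
    (fun b => measurableSet_orthant b) ?_
  have h1 : ∀ᵐ w ∂(limitLaw S : Measure (EuclideanSpace ℝ (Fin m))), ∀ k, w k ≠ a k := by
    rw [ae_all_iff]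
    intro k
    rw [ae_iff]
    simpa using limitLaw_eval_eq hm hS k (a k)
  filter_upwards [h1] with w hw
  have h2 : ∀ k, ∀ᶠ b in 𝓝 a, (w k ≤ b k ↔ w k ≤ a k) := by
    intro k
    have hk : Tendsto (fun b : Fin m → ℝ => b k) (𝓝 a) (𝓝 (a k)) := (continuous_apply k).tendsto a
    rcases lt_or_gt_of_ne (hw k) with h | h
    · filter_upwards [hk.eventually_const_lt h] with b hb
      exact ⟨fun _ => h.le, fun _ => hb.le⟩
    · filter_upwards [hk.eventually_lt_const h] with b hb
      exact ⟨fun h' => absurd h' (not_le.2 hb), fun h' => absurd h' (not_le.2 h)⟩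
  filter_upwards [eventually_all.2 h2] with b hb
  exact forall_congr' hb

/-- A nonempty open set fits between the two orthants and has positive mass. This gives both the
uniqueness of the limiting quantile and β > α. -/
lemma limitCdf_lt (hm : 0 < m) (hS : S.PosDef) {a b : Fin m → ℝ} (hab : a < b) :
    limitCdf S a < limitCdf S b := by
  obtain ⟨hle, k, hk⟩ := Pi.lt_def.1 hab
  have := isOpenPosMeasure_multivariateGaussian (posDef_limitVar hm hS)
  set U : Set (EuclideanSpace ℝ (Fin m)) := {w | (∀ l, w l < b l) ∧ a k < w k}
  have hU : IsOpen U := by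
    have : IsOpen {w : EuclideanSpace ℝ (Fin m) | ∀ l, w l < b l} := by
      rw [Set.ofPred_forall]
      exact isOpen_iInter_of_finite fun l => isOpen_lt (by fun_prop) (by fun_prop)
    exact this.inter (isOpen_lt (continuous_const (y := a k))
      (by fun_prop : Continuous fun w : EuclideanSpace ℝ (Fin m) => w k))
  have hne : U.Nonempty := by
    refine ⟨WithLp.toLp 2 fun l => if l = k then (a k + b k) / 2 else b l - 1, fun l => ?_, ?_⟩
    · by_cases h : l = k
      · subst h; simp; linarith
      · simp [h]
    · simp; linarith
  have hpos : 0 < (limitLaw S : Measure (EuclideanSpace ℝ (Fin m))).real U := by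
    rw [measureReal_def, ENNReal.toReal_pos_iff]
    exact ⟨hU.measure_pos (multivariateGaussian 0 (limitVar S)) hne, measure_lt_top _ _⟩
  have hd : Disjoint {w : EuclideanSpace ℝ (Fin m) | ∀ k, w k ≤ a k} U := by
    rw [Set.disjoint_left]
    intro w hw hw'
    exact absurd (hw k) (not_le.2 hw'.2)
  have hsub : {w : EuclideanSpace ℝ (Fin m) | ∀ k, w k ≤ a k} ∪ U ⊆
      {w | ∀ k, w k ≤ b k} := by
    rintro w (hw | hw) l
    · exact (hw l).trans (hle l)
    · exact (hw.1 l).le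
  have h3 := measureReal_mono hsub (μ := (limitLaw S : Measure (EuclideanSpace ℝ (Fin m))))
  rw [measureReal_union hd hU.measurableSet] at h3
  unfold limitCdf
  linarith

lemma tendsto_limitCdf_const_atTop (S : Matrix (Fin m) (Fin m) ℝ) :
    Tendsto (fun c : ℝ => limitCdf S fun _ => c) atTop (𝓝 1) := by
  have : (1 : ℝ) = (limitLaw S : Measure (EuclideanSpace ℝ (Fin m))).real Set.univ := by simp
  rw [this]
  refine (ENNReal.tendsto_toReal (measure_ne_top _ _)).comp ?_
  refine tendsto_measure_of_ae_tendsto_indicator_of_isFiniteMeasure _ MeasurableSet.univ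
    (fun c => measurableSet_orthant fun _ => c) (ae_of_all _ fun w => ?_)
  filter_upwards [eventually_all.2 fun k => eventually_ge_atTop (w k)] with c hc
  simpa using hc

lemma tendsto_limitCdf_const_atBot (hm : 0 < m) (S : Matrix (Fin m) (Fin m) ℝ) :
    Tendsto (fun c : ℝ => limitCdf S fun _ => c) atBot (𝓝 0) := by
  have : (0 : ℝ) = (limitLaw S : Measure (EuclideanSpace ℝ (Fin m))).real ∅ := by simp
  rw [this]
  refine (ENNReal.tendsto_toReal (measure_ne_top _ _)).comp ?_
  refine tendsto_measure_of_ae_tendsto_indicator_of_isFiniteMeasure _ MeasurableSet.empty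
    (fun c => measurableSet_orthant fun _ => c) (ae_of_all _ fun w => ?_)
  filter_upwards [eventually_lt_atBot (w ⟨0, hm⟩)] with c hc
  simp only [Set.mem_empty_iff_false, iff_false, not_forall, not_le]
  exact ⟨_, hc⟩

lemma exists_limitCdf_const_eq (hm : 0 < m) (hS : S.PosDef) {p : ℝ} (h0 : 0 < p) (h1 : p < 1) :
    ∃ q : ℝ, limitCdf S (fun _ => q) = p := by
  refine mem_range_of_exists_le_of_exists_ge (f := fun q : ℝ => limitCdf S fun _ => q)
    ((continuous_limitCdf hm hS).comp (by fun_prop)) ?_ ?_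
  · exact ((tendsto_limitCdf_const_atBot hm S).eventually_le_const h0).exists
  · exact ((tendsto_limitCdf_const_atTop S).eventually_const_le h1).exists

/-- The joint distribution functions of the recentred statistics converge. -/
lemma tendsto_cdf_centredVec (hm : 0 < m) (hS : S.PosDef)
    (h : Tendsto (fun j => centredLaw (R j) (x j)) atTop (𝓝 (limitLaw S))) (a : Fin m → ℝ) :
    Tendsto (fun j => (drawLaw (N j) (R j)).real {π | ∀ k, uStat (x j) π k (sampleMean (x j) k) ≤ a k})
      atTop (𝓝 (limitCdf S a)) := by
  -- Portmanteau condition: the orthant's frontier is covered by null hyperplanes.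
  have h0 : (limitLaw S : Measure (EuclideanSpace ℝ (Fin m)))
      (frontier {w | ∀ k, w k ≤ a k}) = 0 := by
    refine measure_mono_null (t := ⋃ k, {w | w k = a k}) ?_
      (measure_iUnion_null fun k => limitLaw_eval_eq hm hS k (a k))
    have hc : IsClosed {w : EuclideanSpace ℝ (Fin m) | ∀ k, w k ≤ a k} := by
      rw [Set.ofPred_forall]
      exact isClosed_iInter fun k => isClosed_le (by fun_prop) (by fun_prop)
    have ho : IsOpen {w : EuclideanSpace ℝ (Fin m) | ∀ k, w k < a k} := by
      rw [Set.ofPred_forall]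
      exact isOpen_iInter_of_finite fun k => isOpen_lt (by fun_prop) (by fun_prop)
    intro w hw
    rw [hc.frontier_eq] at hw
    by_contra hcon
    simp only [Set.mem_iUnion, Set.mem_ofPred_eq, not_exists] at hcon
    refine hw.2 (interior_maximal (fun v hv k => (hv k).le) ho ?_)
    exact fun k => lt_of_le_of_ne (hw.1 k) (hcon k)
  have := ProbabilityMeasure.tendsto_measure_of_null_frontier_of_tendsto' h h0
  refine ((ENNReal.tendsto_toReal (measure_ne_top _ _)).comp this).congr fun j => ?_
  exact centredLaw_apply (x j) (measurableSet_orthant a)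

lemma tendsto_limitLaw_eval_le_neg (S : Matrix (Fin m) (Fin m) ℝ) (k : Fin m) :
    Tendsto (fun B : ℝ => (limitLaw S : Measure (EuclideanSpace ℝ (Fin m))).real {w | w k ≤ -B})
      atTop (𝓝 0) := by
  have : (0 : ℝ) = (limitLaw S : Measure (EuclideanSpace ℝ (Fin m))).real ∅ := by simp
  rw [this]
  refine (ENNReal.tendsto_toReal (measure_ne_top _ _)).comp ?_
  refine tendsto_measure_of_ae_tendsto_indicator_of_isFiniteMeasure _ MeasurableSet.empty
    (fun B => measurableSet_le (by fun_prop) (by fun_prop)) (ae_of_all _ fun w => ?_)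
  filter_upwards [eventually_gt_atTop (-w k)] with B hB
  simp only [Set.mem_empty_iff_false, iff_false, not_le]
  linarith

/-- The marginal distribution functions of the recentred statistics converge. -/
lemma tendsto_marginal_centredVec (hm : 0 < m) (hS : S.PosDef)
    (h : Tendsto (fun j => centredLaw (R j) (x j)) atTop (𝓝 (limitLaw S))) (k : Fin m) (c : ℝ) :
    Tendsto (fun j => (drawLaw (N j) (R j)).real {π | uStat (x j) π k (sampleMean (x j) k) ≤ c})
      atTop (𝓝 ((limitLaw S : Measure (EuclideanSpace ℝ (Fin m))).real {w | w k ≤ c})) := by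
  have h0 : (limitLaw S : Measure (EuclideanSpace ℝ (Fin m))) (frontier {w | w k ≤ c}) = 0 :=
    measure_mono_null (frontier_le_subset_eq (by fun_prop) (by fun_prop))
      (limitLaw_eval_eq hm hS k c)
  have := ProbabilityMeasure.tendsto_measure_of_null_frontier_of_tendsto' h h0
  refine ((ENNReal.tendsto_toReal (measure_ne_top _ _)).comp this).congr fun j => ?_
  exact centredLaw_apply (x j) (measurableSet_le (by fun_prop) (by fun_prop))

end

section

/-! ### The critical value -/

/-- The distribution function of the recentred maximum when the data are held fixed. -/
def centredCdf {n m : ℕ} (R : ℕ) (x : Sample n m) (c : ℝ) : ℝ :=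
  (drawLaw n R).real {π | centredStat x π ≤ c}

lemma centredCdf_mono {n m : ℕ} (R : ℕ) (x : Sample n m) : Monotone (centredCdf R x) :=
  fun _ _ hcd => measureReal_mono fun _ h => h.trans hcd

/-- There are finitely many draws, so the distribution function vanishes far enough to the left.
Boundedness keeps `sInf` from taking its default value. -/
lemma bddBelow_critVal {n m R : ℕ} {α : ℝ} (hα : α < 1) (x : Sample n m) :
    BddBelow {c : ℝ | 1 - α ≤ centredCdf R x c} := by
  obtain ⟨b, hb⟩ := (Set.finite_range (centredStat x : Draws n R → ℝ)).bddBelow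
  refine ⟨b, fun c hc => ?_⟩
  by_contra! hcb
  have h0 : {π : Draws n R | centredStat x π ≤ c} = ∅ := by
    ext π
    simp only [Set.mem_ofPred_eq, Set.mem_empty_iff_false, iff_false, not_le]
    exact hcb.trans_le (hb ⟨π, rfl⟩)
  have : 1 - α ≤ centredCdf R x c := hc
  rw [centredCdf, h0, measureReal_empty] at this
  linarith

lemma nonempty_critVal {n m R : ℕ} {α : ℝ} (hα : 0 < α) (x : Sample n m) :
    {c : ℝ | 1 - α ≤ centredCdf R x c}.Nonempty := by
  obtain ⟨b, hb⟩ := (Set.finite_range (centredStat x : Draws n R → ℝ)).bddAbove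
  refine ⟨b, ?_⟩
  have h0 : {π : Draws n R | centredStat x π ≤ b} = Set.univ := by
    ext π
    simpa using hb ⟨π, rfl⟩
  change 1 - α ≤ centredCdf R x b
  rw [centredCdf, h0, probReal_univ]
  linarith

lemma critVal_le {n m R : ℕ} {α c : ℝ} (hα : α < 1) (x : Sample n m)
    (h : 1 - α ≤ centredCdf R x c) : critVal R α x ≤ c :=
  csInf_le (bddBelow_critVal hα x) h

lemma le_critVal {n m R : ℕ} {α c : ℝ} (hα : 0 < α) (x : Sample n m)
    (h : centredCdf R x c < 1 - α) : c ≤ critVal R α x := by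
  refine le_csInf (nonempty_critVal hα x) fun d hd => ?_
  by_contra! hdc
  have h1 := centredCdf_mono R x hdc.le
  have h2 : 1 - α ≤ centredCdf R x d := hd
  linarith

/-- Right continuity of a step function with finitely many jumps. It expresses sublevel sets of the
critical value through probabilities, which yields measurability in the data. -/
lemma critVal_le_iff {n m R : ℕ} {α : ℝ} (hα₀ : 0 < α) (hα₁ : α < 1) (x : Sample n m) (c : ℝ) :
    critVal R α x ≤ c ↔ 1 - α ≤ centredCdf R x c := by
  refine ⟨fun h => ?_, critVal_le hα₁ x⟩
  by_contra! hc
  have h1 : ∀ π : Draws n R, ∀ᶠ d in 𝓝[>] c, (centredStat x π ≤ d ↔ centredStat x π ≤ c) := by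
    intro π
    rcases le_or_gt (centredStat x π) c with h | h
    · filter_upwards [self_mem_nhdsWithin] with d hd
      exact ⟨fun _ => h, fun _ => h.trans (le_of_lt hd)⟩
    · filter_upwards [nhdsWithin_le_nhds (eventually_lt_nhds h)] with d hd
      exact ⟨fun h' => absurd h' (not_le.2 hd), fun h' => absurd h' (not_le.2 h)⟩
  obtain ⟨d, hd, hcd⟩ := ((eventually_all.2 h1).and self_mem_nhdsWithin).exists
  have h2 : centredCdf R x d = centredCdf R x c := by
    unfold centredCdf
    congr 1
    ext π
    exact hd π
  have := le_critVal hα₀ x (h2.trans_lt hc)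
  exact absurd (this.trans h) (not_le.2 hcd)

lemma centredStat_le_iff {n m R : ℕ} (hm : 0 < m) (x : Sample n m) (π : Draws n R) (c : ℝ) :
    centredStat x π ≤ c ↔ ∀ k, uStat x π k (sampleMean x k) ≤ c := by
  have : Nonempty (Fin m) := ⟨⟨0, hm⟩⟩
  exact ciSup_le_iff (Set.finite_range _).bddAbove

variable {m : ℕ} {δ M : ℝ} {S : Matrix (Fin m) (Fin m) ℝ} {N R : ℕ → ℕ} {x : ∀ j, Sample (N j) m}

/-- Quantiles converge when distribution functions converge pointwise to a strictly increasing one.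
-/
lemma tendsto_critVal (hm : 0 < m) (hS : S.PosDef) {α q : ℝ} (hα₀ : 0 < α) (hα₁ : α < 1)
    (hq : limitCdf S (fun _ => q) = 1 - α)
    (h : Tendsto (fun j => centredLaw (R j) (x j)) atTop (𝓝 (limitLaw S))) :
    Tendsto (fun j => critVal (R j) α (x j)) atTop (𝓝 q) := by
  have : Nonempty (Fin m) := ⟨⟨0, hm⟩⟩
  have hF : ∀ c : ℝ, Tendsto (fun j => centredCdf (R j) (x j) c) atTop
      (𝓝 (limitCdf S fun _ => c)) := by
    intro c
    refine (tendsto_cdf_centredVec hm hS h fun _ => c).congr fun j => ?_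
    simp only [centredCdf, centredStat_le_iff hm]
  have hlt : ∀ c d : ℝ, c < d → limitCdf S (fun _ => c) < limitCdf S (fun _ => d) :=
    fun c d hcd => limitCdf_lt hm hS (Function.const_lt_const.2 hcd)
  refine tendsto_order.2 ⟨fun a ha => ?_, fun b hb => ?_⟩
  · obtain ⟨c, hac, hcq⟩ := exists_between ha
    filter_upwards [(hF c).eventually_lt_const (hq ▸ hlt c q hcq)] with j hj
    exact hac.trans_le (le_critVal hα₀ _ hj)
  · obtain ⟨c, hqc, hcb⟩ := exists_between hb
    filter_upwards [(hF c).eventually_const_lt (hq ▸ hlt q c hqc)] with j hj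
    exact (critVal_le hα₁ _ hj.le).trans_lt hcb

/-! ### The shift of the test statistic -/

/-- The normalized sum of the centred draws. -/
def linStat {n m R : ℕ} (x : Sample n m) (π : Draws n R) (k : Fin m) : ℝ :=
  (√(m * R))⁻¹ * ∑ r, sumTerm x (π r) k

/-- The difference between the components of the test statistic and the recentred statistics. -/
def shift {n m R : ℕ} (x : Sample n m) (π : Draws n R) (k : Fin m) : ℝ :=
  (sampleVar x k k)⁻¹ * (max (sampleMean x k) 0 * linStat x π k
    + √(R / m) * max (sampleMean x k) 0 ^ 2)

lemma inv_sqrt_mul_mul (m R : ℕ) : (√(m * R : ℝ))⁻¹ * R = √(R / m : ℝ) := by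
  rw [Real.sqrt_mul (Nat.cast_nonneg m), Real.sqrt_div (Nat.cast_nonneg R), mul_inv, mul_assoc,
    inv_mul_eq_div (√(R : ℝ)), Real.div_sqrt, div_eq_inv_mul]

lemma lambdaHat_eq {n m R : ℕ} (x : Sample n m) (π : Draws n R) (k : Fin m) :
    lambdaHat x π k = (sampleVar x k k)⁻¹ * (sampleMean x k * linStat x π k
      + √(R / m) * sampleMean x k ^ 2) := by
  have e : ∑ r, (drawn x (π r) 0 k + drawn x (π r) 1 k)
      = ∑ r, sumTerm x (π r) k + R * (2 * sampleMean x k) := by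
    simp only [sumTerm, Finset.sum_sub_distrib]; simp
  rw [lambdaHat, linStat, e, ← inv_sqrt_mul_mul m R]
  ring

/-- Expanding the recentred product shows that λ̂ is exactly the effect of recentring. -/
lemma uStat_zero {n m R : ℕ} (x : Sample n m) (π : Draws n R) (k : Fin m) :
    uStat x π k 0 = uStat x π k (sampleMean x k) + lambdaHat x π k := by
  have e : ∑ r, (drawn x (π r) 0 k - 0) * (sampleVar x k k)⁻¹ * (drawn x (π r) 1 k - 0)
      = ∑ r, pairTerm x (π r) k + sampleMean x k * (sampleVar x k k)⁻¹ *
        ∑ r, (drawn x (π r) 0 k + drawn x (π r) 1 k)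
        - R * ((sampleVar x k k)⁻¹ * sampleMean x k ^ 2) := by
    rw [Finset.mul_sum, ← Finset.sum_add_distrib]
    have : (R : ℝ) * ((sampleVar x k k)⁻¹ * sampleMean x k ^ 2)
        = ∑ _r : Fin R, (sampleVar x k k)⁻¹ * sampleMean x k ^ 2 := by simp
    rw [this, ← Finset.sum_sub_distrib]
    refine Finset.sum_congr rfl fun r _ => ?_
    rw [pairTerm]; ring
  rw [uStat_sampleMean, lambdaHat, uStat, e, ← inv_sqrt_mul_mul m R]
  ring

/-- For a negative sample mean the correction cancels the effect of recentring; otherwise the whole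
of λ̂ remains. The positive part of the mean covers both cases. -/
lemma testStat_eq {n m R : ℕ} (x : Sample n m) (π : Draws n R) :
    testStat x π = ⨆ k, (uStat x π k (sampleMean x k) + shift x π k) := by
  unfold testStat
  congr 1 with k
  rw [uStat_zero, shift]
  split_ifs with h
  · rw [max_eq_right h.le]; simp
  · rw [max_eq_left (not_lt.1 h), lambdaHat_eq]; ring

lemma testStat_le_iff {n m R : ℕ} (hm : 0 < m) (x : Sample n m) (π : Draws n R) (c : ℝ) :
    testStat x π ≤ c ↔ ∀ k, uStat x π k (sampleMean x k) + shift x π k ≤ c := by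
  have : Nonempty (Fin m) := ⟨⟨0, hm⟩⟩
  rw [testStat_eq]
  exact ciSup_le_iff (Set.finite_range _).bddAbove

/-- A Chebyshev bound for the normalized sum of the centred draws. -/
lemma measureReal_linStat_le {n m R : ℕ} (hn : 2 ≤ n) (hm : 0 < m) (hR : 0 < R) (x : Sample n m)
    (k : Fin m) (b : ℝ) {ε : ℝ} (hε : 0 < ε) :
    (drawLaw n R).real {π | ε ≤ |b * linStat x π k|} ≤ b ^ 2 * (4 * sampleVar x k k) / ε ^ 2 := by
  have hmem : ∀ _r : Fin R, MemLp (fun σ => sumTerm x σ k) 2 (permLaw n) := fun _ => .of_discrete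
  have hvar := variance_sum_pi (μ := fun _ : Fin R => permLaw n) hmem
  have h1 : Var[fun σ => sumTerm x σ k; permLaw n] ≤ 4 * sampleVar x k k := by
    rw [variance_of_integral_eq_zero (measurable_of_finite _).aemeasurable
      (integral_sumTerm hn x k)]
    exact integral_sumTerm_sq_le hn x k
  have e : (fun π : Draws n R => b * linStat x π k)
      = fun π => (b * (√(m * R))⁻¹) * (∑ r, fun π : Draws n R => sumTerm x (π r) k) π := by
    ext π; simp [linStat]; ring
  have h2 : Var[fun π : Draws n R => b * linStat x π k; drawLaw n R]
      ≤ b ^ 2 * (4 * sampleVar x k k) := by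
    rw [e, variance_const_mul, drawLaw_eq, hvar, Finset.sum_const, Finset.card_univ,
      Fintype.card_fin, nsmul_eq_mul, mul_pow, inv_pow, Real.sq_sqrt (by positivity), mul_assoc]
    refine mul_le_mul_of_nonneg_left ?_ (sq_nonneg b)
    have hR' : (R : ℝ) ≠ 0 := by positivity
    have hm' : (1 : ℝ) ≤ m := by exact_mod_cast hm
    have : ((m : ℝ) * R)⁻¹ * (R * Var[fun σ => sumTerm x σ k; permLaw n])
        = (m : ℝ)⁻¹ * Var[fun σ => sumTerm x σ k; permLaw n] := by field_simp
    rw [this]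
    exact (mul_le_of_le_one_left (variance_nonneg _ _) (inv_le_one_of_one_le₀ hm')).trans h1
  have h3 : ∫ π : Draws n R, b * linStat x π k ∂drawLaw n R = 0 := by
    simp only [linStat]
    rw [integral_const_mul, integral_const_mul, integral_finsetSum _ fun r _ => .of_finite]
    have : ∀ r : Fin R, ∫ π : Draws n R, sumTerm x (π r) k ∂drawLaw n R = 0 := by
      intro r
      rw [drawLaw_eq]
      rw [integral_comp_eval (μ := fun _ : Fin R => permLaw n) (i := r)
        (f := fun σ => sumTerm x σ k) (measurable_of_finite _).aestronglyMeasurable]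
      exact integral_sumTerm hn x k
    simp [this]
  have h4 := meas_ge_le_variance_div_sq (μ := drawLaw n R)
    (X := fun π : Draws n R => b * linStat x π k) .of_discrete hε
  rw [h3] at h4
  simp only [sub_zero] at h4
  rw [measureReal_def]
  refine (ENNReal.toReal_mono ENNReal.ofReal_ne_top h4).trans ?_
  rw [ENNReal.toReal_ofReal (div_nonneg (variance_nonneg _ _) (sq_nonneg _))]
  gcongr

lemma RegularArray.tendsto_linStat (hm : 0 < m) (h : RegularArray δ M S N x)
    (hR : Tendsto R atTop atTop) (k : Fin m) {b : ℕ → ℝ} (hb : Tendsto b atTop (𝓝 0)) {ε : ℝ}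
    (hε : 0 < ε) :
    Tendsto (fun j => (drawLaw (N j) (R j)).real {π | ε ≤ |b j * linStat (x j) π k|}) atTop
      (𝓝 0) := by
  have h1 : Tendsto (fun j => b j ^ 2 * (4 * sampleVar (x j) k k) / ε ^ 2) atTop (𝓝 0) := by
    have := ((hb.pow 2).mul ((h.var k k).const_mul 4)).div_const (ε ^ 2)
    simpa using this
  refine squeeze_zero' (.of_forall fun _ => measureReal_nonneg) ?_ h1
  filter_upwards [h.size.eventually_ge_atTop 2, hR.eventually_gt_atTop 0] with j hj hRj
  exact measureReal_linStat_le hj hm hRj (x j) k (b j) hε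

lemma sqrt_eq_rpow_quarter_sq {r : ℝ} (hr : 0 ≤ r) : √r = (r ^ (1 / 4 : ℝ)) ^ 2 := by
  rw [Real.sqrt_eq_rpow, ← Real.rpow_natCast, ← Real.rpow_mul hr]; norm_num

lemma tendsto_rpow_quarter (hR : Tendsto R atTop atTop) :
    Tendsto (fun j => (R j : ℝ) ^ (1 / 4 : ℝ)) atTop atTop :=
  (tendsto_rpow_atTop (by norm_num)).comp (tendsto_natCast_atTop_atTop.comp hR)

/-- Since √R = (R^{1/4})², the quadratic part depends on R only through the scaled mean R^{1/4}X̄,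
while the linear part keeps a vanishing factor R^{-1/4}. -/
lemma shift_eq {n m R : ℕ} (hR : 0 < R) (x : Sample n m) (π : Draws n R) (k : Fin m) :
    shift x π k = (sampleVar x k k)⁻¹ * (((R : ℝ) ^ (1 / 4 : ℝ))⁻¹ *
        max ((R : ℝ) ^ (1 / 4 : ℝ) * sampleMean x k) 0 * linStat x π k
      + (√m)⁻¹ * max ((R : ℝ) ^ (1 / 4 : ℝ) * sampleMean x k) 0 ^ 2) := by
  have hr : 0 < (R : ℝ) ^ (1 / 4 : ℝ) := by positivity
  have e : max ((R : ℝ) ^ (1 / 4 : ℝ) * sampleMean x k) 0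
      = (R : ℝ) ^ (1 / 4 : ℝ) * max (sampleMean x k) 0 := by
    rw [mul_max_of_nonneg _ _ hr.le, mul_zero]
  rw [e, shift, Real.sqrt_div (Nat.cast_nonneg R), sqrt_eq_rpow_quarter_sq (Nat.cast_nonneg R)]
  field_simp

lemma RegularArray.tendsto_shift (hm : 0 < m) (h : RegularArray δ M S N x)
    (hR : Tendsto R atTop atTop) {k : Fin m} (hS : S k k ≠ 0) {y : ℝ}
    (hy : Tendsto (fun j => max ((R j : ℝ) ^ (1 / 4 : ℝ) * sampleMean (x j) k) 0) atTop (𝓝 y))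
    {ε : ℝ} (hε : 0 < ε) :
    Tendsto (fun j => (drawLaw (N j) (R j)).real
      {π | ε ≤ |shift (x j) π k - (S k k)⁻¹ * ((√m)⁻¹ * y ^ 2)|}) atTop (𝓝 0) := by
  set b : ℕ → ℝ := fun j => (sampleVar (x j) k k)⁻¹ * (((R j : ℝ) ^ (1 / 4 : ℝ))⁻¹ *
    max ((R j : ℝ) ^ (1 / 4 : ℝ) * sampleMean (x j) k) 0)
  have hb : Tendsto b atTop (𝓝 0) := by
    have := ((h.var k k).inv₀ hS).mul
      ((tendsto_inv_atTop_zero.comp (tendsto_rpow_quarter hR)).mul hy)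
    rw [zero_mul, mul_zero] at this
    exact this
  have hd : Tendsto (fun j => (sampleVar (x j) k k)⁻¹ * ((√m)⁻¹ *
      max ((R j : ℝ) ^ (1 / 4 : ℝ) * sampleMean (x j) k) 0 ^ 2)) atTop
      (𝓝 ((S k k)⁻¹ * ((√m)⁻¹ * y ^ 2))) :=
    ((h.var k k).inv₀ hS).mul ((hy.pow 2).const_mul _)
  refine squeeze_zero' (.of_forall fun _ => measureReal_nonneg) ?_
    (h.tendsto_linStat hm hR k hb (half_pos hε))
  filter_upwards [(Metric.tendsto_nhds.1 hd) (ε / 2) (half_pos hε), hR.eventually_gt_atTop 0]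
    with j hj hRj
  refine measureReal_mono fun π hπ => ?_
  simp only [Set.mem_ofPred_eq] at hπ ⊢
  rw [Real.dist_eq] at hj
  have e : shift (x j) π k - (S k k)⁻¹ * ((√m)⁻¹ * y ^ 2) = b j * linStat (x j) π k +
      ((sampleVar (x j) k k)⁻¹ * ((√m)⁻¹ *
        max ((R j : ℝ) ^ (1 / 4 : ℝ) * sampleMean (x j) k) 0 ^ 2)
        - (S k k)⁻¹ * ((√m)⁻¹ * y ^ 2)) := by
    rw [shift_eq hRj]; simp only [b]; ring
  rw [e] at hπ
  have := hπ.trans (abs_add_le _ _)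
  linarith

/-- Outside the event |R^{-1/4} `linStat`| ≥ 1, of vanishing probability, the shift is at least
Σ_kk⁻¹ y(y/√m - 1) with y the positive part of the scaled mean. -/
lemma RegularArray.tendsto_shift_atTop (hm : 0 < m) (h : RegularArray δ M S N x)
    (hR : Tendsto R atTop atTop) {k : Fin m} (hS : 0 < S k k)
    (hy : Tendsto (fun j => (R j : ℝ) ^ (1 / 4 : ℝ) * sampleMean (x j) k) atTop atTop) (B : ℝ) :
    Tendsto (fun j => (drawLaw (N j) (R j)).real {π | shift (x j) π k ≤ B}) atTop (𝓝 0) := by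
  have hy' : Tendsto (fun j => max ((R j : ℝ) ^ (1 / 4 : ℝ) * sampleMean (x j) k) 0) atTop atTop :=
    tendsto_atTop_mono (fun j => le_max_left _ _) hy
  have hm' : 0 < √(m : ℝ) := by positivity
  have hl : Tendsto (fun j => (sampleVar (x j) k k)⁻¹ *
      (max ((R j : ℝ) ^ (1 / 4 : ℝ) * sampleMean (x j) k) 0 * ((√m)⁻¹ *
        max ((R j : ℝ) ^ (1 / 4 : ℝ) * sampleMean (x j) k) 0 + -1))) atTop atTop := by
    refine Tendsto.pos_mul_atTop (inv_pos.2 hS) ((h.var k k).inv₀ hS.ne') ?_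
    exact hy'.atTop_mul_atTop₀
      (tendsto_atTop_add_const_right _ _ (hy'.const_mul_atTop (inv_pos.2 hm')))
  refine squeeze_zero' (.of_forall fun _ => measureReal_nonneg) ?_
    (h.tendsto_linStat hm hR k (tendsto_inv_atTop_zero.comp (tendsto_rpow_quarter hR)) one_pos)
  filter_upwards [hl.eventually_gt_atTop B, hR.eventually_gt_atTop 0,
    (h.var k k).eventually_const_lt hS] with j hj hRj hVj
  refine measureReal_mono fun π hπ => ?_
  simp only [Set.mem_ofPred_eq, Function.comp] at hπ ⊢
  by_contra! hlt
  have h1 := (abs_lt.1 hlt).1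
  rw [shift_eq hRj] at hπ
  set y := max ((R j : ℝ) ^ (1 / 4 : ℝ) * sampleMean (x j) k) 0
  have hy0 : 0 ≤ y := le_max_right _ _
  have : (sampleVar (x j) k k)⁻¹ * (y * ((√m)⁻¹ * y + -1)) ≤
      (sampleVar (x j) k k)⁻¹ * (((R j : ℝ) ^ (1 / 4 : ℝ))⁻¹ * y * linStat (x j) π k
      + (√m)⁻¹ * y ^ 2) := by
    refine mul_le_mul_of_nonneg_left ?_ (inv_pos.2 hVj).le
    nlinarith
  linarith

/-! ### Limits of rejection probabilities along regular arrays -/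

/-- The rejection probability when the data are held fixed. -/
def condRejection {n m : ℕ} (R : ℕ) (α : ℝ) (x : Sample n m) : ℝ :=
  (drawLaw n R).real {π | critVal R α x < testStat x π}

lemma condRejection_eq {n m : ℕ} (hm : 0 < m) (R : ℕ) (α : ℝ) (x : Sample n m) :
    condRejection R α x = 1 - (drawLaw n R).real
      {π | ∀ k, uStat x π k (sampleMean x k) + shift x π k ≤ critVal R α x} := by
  rw [condRejection, ← probReal_compl_eq_one_sub (Set.toFinite _).measurableSet]
  congr 1
  ext π
  simp only [Set.mem_compl_iff, Set.mem_ofPred_eq, ← testStat_le_iff hm, not_le]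

/-- Joint distribution functions under perturbations that converge in probability. -/
lemma tendsto_cdf_add {Ω : ℕ → Type*} [∀ j, MeasurableSpace (Ω j)] {μ : ∀ j, Measure (Ω j)}
    [∀ j, IsProbabilityMeasure (μ j)] {m : ℕ} {W T : ∀ j, Ω j → Fin m → ℝ}
    {G : (Fin m → ℝ) → ℝ} (hG : Continuous G)
    (hW : ∀ a, Tendsto (fun j => (μ j).real {ω | ∀ k, W j ω k ≤ a k}) atTop (𝓝 (G a)))
    {s : Fin m → ℝ}
    (hT : ∀ k, ∀ ε : ℝ, 0 < ε → Tendsto (fun j => (μ j).real {ω | ε ≤ |T j ω k - s k|}) atTop (𝓝 0))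
    {c : ℕ → ℝ} {q : ℝ} (hc : Tendsto c atTop (𝓝 q)) :
    Tendsto (fun j => (μ j).real {ω | ∀ k, W j ω k + T j ω k ≤ c j}) atTop
      (𝓝 (G fun k => q - s k)) := by
  -- The margin 2ε is spent half on the perturbation and half on the moving threshold.
  have hcont : Tendsto (fun ε : ℝ => G fun k => q - s k + 2 * ε) (𝓝 0) (𝓝 (G fun k => q - s k)) := by
    have : Continuous fun ε : ℝ => G fun k => q - s k + 2 * ε := hG.comp (by fun_prop)
    simpa using this.tendsto 0
  have hsum : ∀ ε : ℝ, 0 < ε →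
      Tendsto (fun j => ∑ k, (μ j).real {ω | ε ≤ |T j ω k - s k|}) atTop (𝓝 0) := by
    intro ε hε
    simpa using tendsto_finsetSum Finset.univ fun k _ => hT k ε hε
  have hbad : ∀ (ε : ℝ) (j : ℕ) (A B : Set (Ω j)),
      (∀ ω ∈ A, (∀ k, |T j ω k - s k| < ε) → ω ∈ B) →
      (μ j).real A ≤ (μ j).real B + ∑ k, (μ j).real {ω | ε ≤ |T j ω k - s k|} := by
    intro ε j A B hAB
    have hsub : A ⊆ B ∪ ⋃ k, {ω | ε ≤ |T j ω k - s k|} := by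
      intro ω hω
      by_cases hk : ∀ k, |T j ω k - s k| < ε
      · exact Or.inl (hAB ω hω hk)
      · push Not at hk
        exact Or.inr (Set.mem_iUnion.2 hk)
    exact (measureReal_mono hsub).trans ((measureReal_union_le _ _).trans
      (add_le_add_right (measureReal_iUnion_fintype_le _) _))
  refine tendsto_order.2 ⟨fun a ha => ?_, fun b hb => ?_⟩
  · obtain ⟨ε, hε, hGε⟩ : ∃ ε : ℝ, 0 < ε ∧ a < G fun k => q - s k + 2 * (-ε) := by
      have h1 : Tendsto (fun ε : ℝ => G fun k => q - s k + 2 * (-ε)) (𝓝[>] 0)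
          (𝓝 (G fun k => q - s k)) :=
        (hcont.comp (by simpa using (continuous_neg (G := ℝ)).tendsto 0)).mono_left
          nhdsWithin_le_nhds
      obtain ⟨ε, h2, h3⟩ := ((h1.eventually_const_lt ha).and self_mem_nhdsWithin).exists
      exact ⟨ε, h3, h2⟩
    have h1 := (hW fun k => q - s k + 2 * (-ε)).sub (hsum ε hε)
    rw [sub_zero] at h1
    filter_upwards [h1.eventually_const_lt hGε, hc.eventually_const_lt (sub_lt_self q hε)]
      with j hj hcj
    have := hbad ε j {ω | ∀ k, W j ω k ≤ q - s k + 2 * (-ε)} {ω | ∀ k, W j ω k + T j ω k ≤ c j}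
      fun ω hω hk k => by
        have := (abs_lt.1 (hk k)).2
        have := hω k
        linarith
    linarith
  · obtain ⟨ε, hε, hGε⟩ : ∃ ε : ℝ, 0 < ε ∧ (G fun k => q - s k + 2 * ε) < b := by
      obtain ⟨ε, h2, h3⟩ := (((hcont.mono_left nhdsWithin_le_nhds).eventually_lt_const hb).and
        (self_mem_nhdsWithin (a := (0 : ℝ)) (s := Set.Ioi 0))).exists
      exact ⟨ε, h3, h2⟩
    have h1 := (hW fun k => q - s k + 2 * ε).add (hsum ε hε)
    rw [add_zero] at h1
    filter_upwards [h1.eventually_lt_const hGε, hc.eventually_lt_const (lt_add_of_pos_right q hε)]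
      with j hj hcj
    have := hbad ε j {ω | ∀ k, W j ω k + T j ω k ≤ c j} {ω | ∀ k, W j ω k ≤ q - s k + 2 * ε}
      fun ω hω hk k => by
        have := (abs_lt.1 (hk k)).1
        have := hω k
        linarith
    linarith

/-- The limit of the shifts of the test statistic, if the scaled means tend to `d`. -/
def limitShift {m : ℕ} (S : Matrix (Fin m) (Fin m) ℝ) (d : Fin m → EReal) (k : Fin m) : ℝ :=
  (S k k)⁻¹ * ((√m)⁻¹ * (max (d k) 0).toReal ^ 2)

/-- Truncation at 0 sends -∞ to 0, so only +∞ has to be excluded. -/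
lemma tendsto_max_toReal {ι : Type*} {l : Filter ι} {f : ι → ℝ} {d : EReal}
    (hf : Tendsto (fun j => (f j : EReal)) l (𝓝 d)) (hd : d ≠ ⊤) :
    Tendsto (fun j => max (f j) 0) l (𝓝 (max d 0).toReal) := by
  have h1 : Tendsto (fun j => max (f j : EReal) 0) l (𝓝 (max d 0)) := hf.max tendsto_const_nhds
  have h2 : max d 0 ≠ ⊤ := by
    rcases max_choice d 0 with h | h <;> rw [h]
    · exact hd
    · exact EReal.zero_ne_top
  have h3 : max d 0 ≠ ⊥ := by
    intro h
    have := le_max_right d 0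
    rw [h] at this
    exact absurd this (by simp)
  have h4 := (EReal.tendsto_toReal h2 h3).comp h1
  refine h4.congr fun j => ?_
  simp only [Function.comp]
  rw [← EReal.coe_zero, ← EReal.coe_strictMono.monotone.map_max, EReal.toReal_coe]

/-- Rejection probabilities along a regular array with finite limits of the scaled means. -/
lemma RegularArray.tendsto_condRejection (hm : 0 < m) {α : ℝ} (hα₀ : 0 < α) (hα₁ : α < 1)
    (hδ : 0 < δ) (h : RegularArray δ M S N x) (hS : S.PosDef) (hR : Tendsto R atTop atTop)
    (hRN : Tendsto (fun j => √(R j) / (N j : ℝ)) atTop (𝓝 0)) {d : Fin m → EReal}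
    (hd : ∀ k, Tendsto (fun j => (((R j : ℝ) ^ (1 / 4 : ℝ) * sampleMean (x j) k : ℝ) : EReal))
      atTop (𝓝 (d k)))
    (hdt : ∀ k, d k ≠ ⊤) {q : ℝ} (hq : limitCdf S (fun _ => q) = 1 - α) :
    Tendsto (fun j => condRejection (R j) α (x j)) atTop
      (𝓝 (1 - limitCdf S fun k => q - limitShift S d k)) := by
  have hlaw := (h.mono_exponent (le_min hδ.le zero_le_one) (min_le_left δ 1)).tendsto_centredLaw hm
    (lt_min hδ one_pos) (min_le_right _ _) hS hR hRN
  simp only [condRejection_eq hm]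
  refine Tendsto.const_sub 1 ?_
  refine tendsto_cdf_add (μ := fun j => drawLaw (N j) (R j))
    (W := fun j π k => uStat (x j) π k (sampleMean (x j) k)) (T := fun j π k => shift (x j) π k)
    (continuous_limitCdf hm hS) (tendsto_cdf_centredVec hm hS hlaw) (fun k ε hε => ?_)
    (tendsto_critVal hm hS hα₀ hα₁ hq hlaw)
  exact h.tendsto_shift hm hR hS.diag_pos.ne' (tendsto_max_toReal (hd k) (hdt k)) hε

/-- Rejection probabilities along a regular array with a scaled mean that diverges. -/
lemma RegularArray.tendsto_condRejection_one (hm : 0 < m) {α : ℝ} (hα₀ : 0 < α) (hα₁ : α < 1)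
    (hδ : 0 < δ) (h : RegularArray δ M S N x) (hS : S.PosDef) (hR : Tendsto R atTop atTop)
    (hRN : Tendsto (fun j => √(R j) / (N j : ℝ)) atTop (𝓝 0)) {k : Fin m}
    (hk : Tendsto (fun j => (R j : ℝ) ^ (1 / 4 : ℝ) * sampleMean (x j) k) atTop atTop) :
    Tendsto (fun j => condRejection (R j) α (x j)) atTop (𝓝 1) := by
  have hlaw := (h.mono_exponent (le_min hδ.le zero_le_one) (min_le_left δ 1)).tendsto_centredLaw hm
    (lt_min hδ one_pos) (min_le_right _ _) hS hR hRN
  obtain ⟨q, hq⟩ := exists_limitCdf_const_eq hm hS (p := 1 - α) (by linarith) (by linarith)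
  have hc := tendsto_critVal hm hS hα₀ hα₁ hq hlaw
  simp only [condRejection_eq hm]
  suffices Tendsto (fun j => (drawLaw (N j) (R j)).real
      {π | ∀ k, uStat (x j) π k (sampleMean (x j) k) + shift (x j) π k ≤ critVal (R j) α (x j)})
      atTop (𝓝 0) by simpa using this.const_sub 1
  refine tendsto_order.2 ⟨fun a ha => .of_forall fun j => ha.trans_le measureReal_nonneg,
    fun b hb => ?_⟩
  obtain ⟨B, hB⟩ := ((tendsto_limitLaw_eval_le_neg S k).eventually_lt_const hb).exists
  have h1 := (tendsto_marginal_centredVec hm hS hlaw k (-B)).add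
    -- If the recentred component exceeds -B and the shift exceeds B + q + 1, their sum exceeds q +
    -- 1 and hence, eventually, the critical value.
    (h.tendsto_shift_atTop hm hR hS.diag_pos hk (B + (q + 1)))
  rw [add_zero] at h1
  filter_upwards [h1.eventually_lt_const hB, hc.eventually_lt_const (lt_add_one q)] with j hj hcj
  refine lt_of_le_of_lt ?_ hj
  refine (measureReal_mono fun π hπ => ?_).trans (measureReal_union_le _ _)
  have := hπ k
  simp only [Set.mem_union, Set.mem_ofPred_eq]
  by_contra! hcon
  linarith [hcon.1, hcon.2]

end

/-! ### Convergence in probability as convergence along a filter -/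

/-- The filter of the events whose probabilities tend to one along a sequence of probability
spaces. -/
def probFilter {Ω : ℕ → Type*} [∀ n, MeasurableSpace (Ω n)] (μ : ∀ n, Measure (Ω n))
    [∀ n, IsProbabilityMeasure (μ n)] : Filter (Σ n, Ω n) where
  sets := {U | Tendsto (fun n => (μ n).real {ω | ⟨n, ω⟩ ∉ U}) atTop (𝓝 0)}
  univ_sets := by simp
  sets_of_superset := fun {U V} hU hUV => by
    refine squeeze_zero (fun _ => measureReal_nonneg) (fun n => ?_) hU
    exact measureReal_mono fun ω hω hω' => hω (hUV hω')
  inter_sets := fun {U V} hU hV => by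
    refine squeeze_zero (fun _ => measureReal_nonneg) (fun n => ?_)
      (by simpa using Tendsto.add hU hV)
    refine (measureReal_mono fun ω hω => ?_).trans (measureReal_union_le _ _)
    simp only [Set.mem_inter_iff, Set.mem_ofPred_eq, not_and_or] at hω
    exact hω

section ProbFilter

variable {Ω : ℕ → Type*} [∀ n, MeasurableSpace (Ω n)] {μ : ∀ n, Measure (Ω n)}
  [∀ n, IsProbabilityMeasure (μ n)]

lemma mem_probFilter {U : Set (Σ n, Ω n)} :
    U ∈ probFilter μ ↔ Tendsto (fun n => (μ n).real {ω | ⟨n, ω⟩ ∉ U}) atTop (𝓝 0) := Iff.rfl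

lemma tendsto_fst_probFilter : Tendsto Sigma.fst (probFilter μ) atTop := by
  intro s hs
  rw [mem_map, mem_probFilter]
  refine tendsto_const_nhds.congr' ?_
  filter_upwards [hs] with n hn
  simp [hn]

lemma tendsto_probFilter_of_convergesInProb {X : ∀ n, Ω n → ℝ} {c : ℝ}
    (h : ConvergesInProb μ X c) : Tendsto (fun p : Σ n, Ω n => X p.1 p.2) (probFilter μ) (𝓝 c) := by
  refine Metric.tendsto_nhds.2 fun ε hε => ?_
  change _ ∈ probFilter μ
  rw [mem_probFilter]
  refine (h ε hε).congr fun n => ?_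
  congr 1
  ext ω
  simp [Real.dist_eq]

lemma tendsto_probFilter_mul_of_boundedInProb {a : ℕ → ℝ} (ha : Tendsto a atTop (𝓝 0))
    {X : ∀ n, Ω n → ℝ} (h : BoundedInProb μ X) :
    Tendsto (fun p : Σ n, Ω n => a p.1 * X p.1 p.2) (probFilter μ) (𝓝 0) := by
  refine tendsto_probFilter_of_convergesInProb (X := fun n ω => a n * X n ω) fun ε hε => ?_
  refine tendsto_order.2 ⟨fun b hb => .of_forall fun n => hb.trans_le measureReal_nonneg,
    fun b hb => ?_⟩
  obtain ⟨M, hM⟩ := h (b / 2) (half_pos hb)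
  have h1 : Tendsto (fun n => |a n| * |M|) atTop (𝓝 0) := by simpa using ha.abs.mul_const |M|
  filter_upwards [hM, h1.eventually_lt_const hε] with n hn hn1
  refine lt_of_le_of_lt ((measureReal_mono fun ω hω => ?_).trans hn) (half_lt_self hb)
  simp only [Set.mem_ofPred_eq, sub_zero] at hω ⊢
  by_contra! hcon
  rw [abs_mul] at hω
  have : |a n| * |X n ω| ≤ |a n| * |M| :=
    mul_le_mul_of_nonneg_left (hcon.trans (le_abs_self M)) (abs_nonneg _)
  linarith

/-- Bounded functions that converge along the restrictions of a filter to events of probability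
close to one converge in mean. -/
lemma tendsto_integral_of_tendsto_inf_principal {F : Filter (Σ n, Ω n)} (hF : probFilter μ ≤ F)
    {b : ∀ n, Ω n → ℝ} (hb : BoundedInProb μ b) {f : (Σ n, Ω n) → ℝ} {L : ℝ}
    (hL : L ∈ Set.Icc (0 : ℝ) 1) (hf01 : ∀ p, f p ∈ Set.Icc (0 : ℝ) 1)
    (hfm : ∀ n, Measurable fun ω => f ⟨n, ω⟩)
    (hf : ∀ M : ℝ, Tendsto f (F ⊓ 𝓟 {p | ‖b p.1 p.2‖ ≤ M}) (𝓝 L)) :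
    Tendsto (fun n => ∫ ω, f ⟨n, ω⟩ ∂μ n) atTop (𝓝 L) := by
  refine Metric.tendsto_atTop'.2 fun ε hε => ?_
  -- Error budget: ε/4 for an unbounded `b`, ε/4 for the event where convergence fails, and ε/4 for
  -- the deviation elsewhere.
  obtain ⟨M, hM⟩ := hb (ε / 4) (by positivity)
  have h1 : ∀ᶠ p in F, ‖b p.1 p.2‖ ≤ M → |f p - L| < ε / 4 := by
    have := Metric.tendsto_nhds.1 (hf M) (ε / 4) (by positivity)
    exact eventually_inf_principal.1 this
  have h2 := mem_probFilter.1 (hF h1)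
  have h3 : ∀ᶠ n in atTop, dist (∫ ω, f ⟨n, ω⟩ ∂μ n) L < ε := by
    filter_upwards [hM, h2.eventually_lt_const (by positivity : 0 < ε / 4)] with n hn hn2
    have hfi : Integrable (fun ω => f ⟨n, ω⟩) (μ n) :=
      Integrable.of_mem_Icc 0 1 (hfm n).aemeasurable (.of_forall fun ω => hf01 _)
    set A : Set (Ω n) := {ω | ε / 4 ≤ |f ⟨n, ω⟩ - L|}
    have hAm : MeasurableSet A := measurableSet_le measurable_const
      ((hfm n).sub_const L).norm
    have hA : (μ n).real A ≤ ε / 4 + ε / 4 := by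
      refine (measureReal_mono fun ω hω => ?_).trans
        ((measureReal_union_le _ _).trans (add_le_add hn hn2.le))
      by_cases hω' : M < ‖b n ω‖
      · exact Or.inl hω'
      · refine Or.inr fun hcon => ?_
        exact absurd (hcon (not_lt.1 hω')) (not_lt.2 hω)
    have hpt : ∀ ω, |f ⟨n, ω⟩ - L| ≤ ε / 4 + A.indicator 1 ω := by
      intro ω
      by_cases hω : ω ∈ A
      · rw [Set.indicator_of_mem hω, Pi.one_apply]
        have := hf01 ⟨n, ω⟩
        rw [abs_le]
        constructor <;> linarith [this.1, this.2, hL.1, hL.2]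
      · rw [Set.indicator_of_notMem hω, add_zero]
        exact (not_le.1 hω).le
    have hsub : ∫ ω, f ⟨n, ω⟩ ∂μ n - L = ∫ ω, (f ⟨n, ω⟩ - L) ∂μ n := by
      rw [integral_sub hfi (integrable_const _)]; simp
    have hind : Integrable (A.indicator (1 : Ω n → ℝ)) (μ n) :=
      (integrable_const (1 : ℝ)).indicator hAm
    rw [Real.dist_eq, hsub]
    calc |∫ ω, (f ⟨n, ω⟩ - L) ∂μ n| ≤ ∫ ω, |f ⟨n, ω⟩ - L| ∂μ n := abs_integral_le_integral_abs
      _ ≤ ∫ ω, (ε / 4 + A.indicator 1 ω) ∂μ n :=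
        integral_mono (hfi.sub (integrable_const _)).abs ((integrable_const _).add hind) hpt
      _ = ε / 4 + (μ n).real A := by
        rw [integral_add (integrable_const _) hind, integral_indicator_one hAm]; simp
      _ < ε := by linarith
  exact (h3.exists_forall_of_atTop).imp fun a ha n hn => ha n hn.le

end ProbFilter

/-! ### Measurability -/

section Measurability

variable {n m R : ℕ}

lemma measurable_sampleMean (k : Fin m) : Measurable fun x : Sample n m => sampleMean x k := by
  unfold sampleMean; fun_prop

lemma measurable_sampleVar (k l : Fin m) : Measurable fun x : Sample n m => sampleVar x k l := by
  have := measurable_sampleMean (n := n) (m := m)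
  simp only [sampleVar, Matrix.of_apply]
  fun_prop

lemma measurable_drawn (σ : Equiv.Perm (Fin n)) (j : ℕ) (k : Fin m) :
    Measurable fun x : Sample n m => drawn x σ j k := by
  unfold drawn
  split_ifs
  · fun_prop
  · exact measurable_const

lemma measurable_uStat (π : Draws n R) (k : Fin m) {a : Sample n m → ℝ} (ha : Measurable a) :
    Measurable fun x : Sample n m => uStat x π k (a x) := by
  have := measurable_drawn (n := n) (m := m)
  have := measurable_sampleVar (n := n) (m := m)
  unfold uStat
  fun_prop

lemma measurable_lambdaHat (π : Draws n R) (k : Fin m) :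
    Measurable fun x : Sample n m => lambdaHat x π k := by
  have := measurable_drawn (n := n) (m := m)
  have := measurable_sampleVar (n := n) (m := m)
  have := measurable_sampleMean (n := n) (m := m)
  unfold lambdaHat
  fun_prop

lemma measurable_testStat (π : Draws n R) : Measurable fun x : Sample n m => testStat x π := by
  unfold testStat
  refine Measurable.iSup fun k => ?_
  refine (measurable_uStat π k measurable_const).sub ((measurable_lambdaHat π k).mul ?_)
  exact Measurable.ite (measurableSet_lt (measurable_sampleMean k) measurable_const)
    measurable_const measurable_const

lemma measurable_centredStat (π : Draws n R) :
    Measurable fun x : Sample n m => centredStat x π := by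
  unfold centredStat
  exact Measurable.iSup fun k => measurable_uStat π k (measurable_sampleMean k)

/-- Probabilities of the draws are measurable in the data. -/
lemma measurable_drawLaw_real {A : Draws n R → Set (Sample n m)} (hA : ∀ π, MeasurableSet (A π)) :
    Measurable fun x : Sample n m => (drawLaw n R).real {π | x ∈ A π} := by
  have hs : MeasurableSet {p : Sample n m × Draws n R | p.1 ∈ A p.2} := by
    have : {p : Sample n m × Draws n R | p.1 ∈ A p.2} = ⋃ π, A π ×ˢ {π} := by
      ext p; simp
    rw [this]
    exact MeasurableSet.iUnion fun π => (hA π).prod (measurableSet_singleton π)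
  exact (measurable_measure_prodMk_left hs).ennreal_toReal

lemma measurable_critVal {α : ℝ} (hα₀ : 0 < α) (hα₁ : α < 1) :
    Measurable fun x : Sample n m => critVal R α x := by
  refine measurable_of_Iic fun c => ?_
  have : (fun x : Sample n m => critVal R α x) ⁻¹' Set.Iic c
      = {x | 1 - α ≤ (drawLaw n R).real {π | centredStat x π ≤ c}} := by
    ext x
    exact critVal_le_iff hα₀ hα₁ x c
  rw [this]
  exact measurableSet_le measurable_const
    (measurable_drawLaw_real fun π => measurableSet_le (measurable_centredStat π) measurable_const)

lemma measurableSet_reject {α : ℝ} (hα₀ : 0 < α) (hα₁ : α < 1) (π : Draws n R) :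
    MeasurableSet {x : Sample n m | critVal R α x < testStat x π} :=
  measurableSet_lt (measurable_critVal hα₀ hα₁) (measurable_testStat π)

lemma measurable_condRejection {α : ℝ} (hα₀ : 0 < α) (hα₁ : α < 1) :
    Measurable fun x : Sample n m => condRejection R α x :=
  measurable_drawLaw_real fun π => measurableSet_reject hα₀ hα₁ π

/-- Fubini, which needs joint measurability, so that conditional limits given the data can be
integrated. -/
lemma rejectionProb_eq {α : ℝ} (hα₀ : 0 < α) (hα₁ : α < 1) (P : DGP n m) :
    rejectionProb P R α = ∫ x, condRejection R α x ∂P.law := by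
  have hs : MeasurableSet {p : Sample n m × Draws n R | critVal R α p.1 < testStat p.1 p.2} := by
    have : {p : Sample n m × Draws n R | critVal R α p.1 < testStat p.1 p.2}
        = ⋃ π, {x | critVal R α x < testStat x π} ×ˢ {π} := by
      ext p; simp
    rw [this]
    exact MeasurableSet.iUnion fun π =>
      (measurableSet_reject hα₀ hα₁ π).prod (measurableSet_singleton π)
  have e : (fun p : Sample n m × Draws n R => test α p.1 p.2)
      = {p | critVal R α p.1 < testStat p.1 p.2}.indicator 1 := by
    ext p
    simp [test, Set.indicator_apply]
  have hi : Integrable (fun p : Sample n m × Draws n R => test α p.1 p.2)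
      (P.law.prod (drawLaw n R)) := by
    rw [e]
    exact (integrable_const (1 : ℝ)).indicator hs
  rw [rejectionProb, integral_prod _ hi]
  congr 1 with x
  have e2 : (fun π : Draws n R => test α x π) = {π | critVal R α x < testStat x π}.indicator 1 := by
    ext π
    simp [test, Set.indicator_apply]
  rw [e2, integral_indicator_one (Set.toFinite _).measurableSet, condRejection]

end Measurability

/-! ### Random samples -/

lemma EReal.tendsto_coe_add_zero {ι : Type*} {l : Filter ι} {f g : ι → ℝ} {d : EReal}
    (hf : Tendsto (fun i => (f i : EReal)) l (𝓝 d)) (hg : Tendsto g l (𝓝 0)) :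
    Tendsto (fun i => ((f i + g i : ℝ) : EReal)) l (𝓝 d) := by
  have hg' : Tendsto (fun i => (g i : EReal)) l (𝓝 ((0 : ℝ) : EReal)) :=
    (continuous_coe_real_ereal.tendsto 0).comp hg
  have hc : ContinuousAt (fun p : EReal × EReal => p.1 + p.2) (d, ((0 : ℝ) : EReal)) :=
    EReal.continuousAt_add (Or.inr (EReal.coe_ne_bot 0)) (Or.inr (EReal.coe_ne_top 0))
  have := hc.tendsto.comp (hf.prodMk_nhds hg')
  simpa [Function.comp_def] using this

/-- The filter of samples of growing size, converging variance matrix, and converging scaled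
means. -/
def sampleFilter {m : ℕ} (R : ℕ → ℕ) (S : Matrix (Fin m) (Fin m) ℝ) (d : Fin m → EReal) :
    Filter (Σ n, Sample n m) :=
  comap Sigma.fst atTop ⊓ (⨅ k, ⨅ l, comap (fun p => sampleVar p.2 k l) (𝓝 (S k l))) ⊓
    ⨅ k, comap (fun p => (((R p.1 : ℝ) ^ (1 / 4 : ℝ) * sampleMean p.2 k : ℝ) : EReal)) (𝓝 (d k))

section SampleFilter

variable {m : ℕ} {R : ℕ → ℕ} {S : Matrix (Fin m) (Fin m) ℝ} {d : Fin m → EReal}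

/-- Countable generation lets limits along this filter be tested on sequences, that is, on
deterministic arrays of samples. -/
instance : (sampleFilter R S d).IsCountablyGenerated := by
  have h1 : (⨅ k, ⨅ l, comap (fun p : Σ n, Sample n m => sampleVar p.2 k l)
      (𝓝 (S k l))).IsCountablyGenerated :=
    have (k : Fin m) : (⨅ l, comap (fun p : Σ n, Sample n m => sampleVar p.2 k l)
      (𝓝 (S k l))).IsCountablyGenerated := iInf.isCountablyGenerated _
    iInf.isCountablyGenerated _
  have h2 : (⨅ k, comap (fun p : Σ n, Sample n m =>
      (((R p.1 : ℝ) ^ (1 / 4 : ℝ) * sampleMean p.2 k : ℝ) : EReal)) (𝓝 (d k))).IsCountablyGenerated :=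
    iInf.isCountablyGenerated _
  unfold sampleFilter
  infer_instance

lemma tendsto_sampleFilter_iff {ι : Type*} {l : Filter ι} {u : ι → Σ n, Sample n m} :
    Tendsto u l (sampleFilter R S d) ↔ (Tendsto (fun i => (u i).1) l atTop ∧
      ∀ k k', Tendsto (fun i => sampleVar (u i).2 k k') l (𝓝 (S k k'))) ∧
      ∀ k, Tendsto (fun i => (((R (u i).1 : ℝ) ^ (1 / 4 : ℝ) * sampleMean (u i).2 k : ℝ) : EReal)) l
        (𝓝 (d k)) := by
  simp only [sampleFilter, tendsto_inf, tendsto_iInf, tendsto_comap_iff, Function.comp_def]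

/-- The scaled sample mean differs from the scaled population mean by (R^{1/4}/√n)·O_P(1), and
R^{1/4}/√n is the square root of √R/n. -/
lemma probFilter_le_sampleFilter {P : ∀ n, DGP n m} {δ L U : ℝ} (hP : RegularSequence δ L U P)
    (hS : ∀ k l, ConvergesInProb (fun n => (P n).law) (fun _ x => sampleVar x k l) (S k l))
    (hRn : Tendsto (fun n : ℕ => Real.sqrt (R n) / (n : ℝ)) atTop (𝓝 0))
    (hd : ∀ k, Tendsto (fun n => (((R n : ℝ) ^ (1 / 4 : ℝ) * (P n).mean k : ℝ) : EReal))
      atTop (𝓝 (d k))) :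
    probFilter (fun n => (P n).law) ≤ sampleFilter R S d := by
  refine tendsto_id'.1 (tendsto_sampleFilter_iff.2 ⟨⟨tendsto_fst_probFilter, fun k l =>
    tendsto_probFilter_of_convergesInProb (X := fun _ x => sampleVar x k l) (hS k l)⟩, fun k => ?_⟩)
  have hb : BoundedInProb (fun n => (P n).law)
      (fun n (x : Sample n m) => (√n)⁻¹ * ∑ i, (x i k - (P n).mean k)) := by
    intro ε hε
    obtain ⟨M, hM⟩ := hP.rootN ε hε
    refine ⟨M, hM.mono fun n hn => (measureReal_mono fun x hx => ?_).trans hn⟩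
    exact lt_of_lt_of_le hx
      (norm_le_pi_norm (fun k => (√n)⁻¹ * ∑ i, (x i k - (P n).mean k)) k)
  have ha : Tendsto (fun n : ℕ => (R n : ℝ) ^ (1 / 4 : ℝ) * (√n)⁻¹) atTop (𝓝 0) := by
    have := hRn.sqrt
    rw [Real.sqrt_zero] at this
    refine this.congr fun n => ?_
    rw [Real.sqrt_div (Real.sqrt_nonneg _), sqrt_eq_rpow_quarter_sq (Nat.cast_nonneg _),
      Real.sqrt_sq (by positivity), div_eq_mul_inv]
  have h1 := tendsto_probFilter_mul_of_boundedInProb ha hb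
  have h2 := EReal.tendsto_coe_add_zero
    ((hd k).comp (tendsto_fst_probFilter (μ := fun n => (P n).law))) h1
  refine h2.congr' ?_
  filter_upwards [(tendsto_fst_probFilter (μ := fun n => (P n).law)).eventually_gt_atTop 0]
    with p hp
  congr 1
  have hn : (0 : ℝ) < p.1 := by exact_mod_cast hp
  have e : (√(p.1 : ℝ))⁻¹ * (√(p.1 : ℝ))⁻¹ = (p.1 : ℝ)⁻¹ := by
    rw [← mul_inv, Real.mul_self_sqrt hn.le]
  have e2 : sampleMean p.2 k = (P p.1).mean k
      + (p.1 : ℝ)⁻¹ * ∑ i, (p.2 i k - (P p.1).mean k) := by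
    simp only [sampleMean, Finset.sum_sub_distrib, Finset.sum_const, Finset.card_univ,
      Fintype.card_fin, nsmul_eq_mul]
    field_simp
    ring
  simp only [id]
  rw [e2, ← e]
  ring

/-- If conditional rejection probabilities converge along all regular arrays of samples, then the
rejection probabilities converge. -/
lemma tendsto_rejectionProb {α : ℝ} (hα₀ : 0 < α) (hα₁ : α < 1) {P : ∀ n, DGP n m} {δ L U : ℝ}
    (hP : RegularSequence δ L U P)
    (hS : ∀ k l, ConvergesInProb (fun n => (P n).law) (fun _ x => sampleVar x k l) (S k l))
    (hR : Tendsto R atTop atTop)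
    (hRn : Tendsto (fun n : ℕ => Real.sqrt (R n) / (n : ℝ)) atTop (𝓝 0))
    (hd : ∀ k, Tendsto (fun n => (((R n : ℝ) ^ (1 / 4 : ℝ) * (P n).mean k : ℝ) : EReal))
      atTop (𝓝 (d k))) {ℓ : ℝ} (hℓ : ℓ ∈ Set.Icc (0 : ℝ) 1)
    (h : ∀ (M : ℝ) (N : ℕ → ℕ) (x : ∀ j, Sample (N j) m), RegularArray δ M S N x →
      Tendsto (R ∘ N) atTop atTop →
      Tendsto (fun j => √(R (N j)) / (N j : ℝ)) atTop (𝓝 0) →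
      (∀ k, Tendsto (fun j => (((R (N j) : ℝ) ^ (1 / 4 : ℝ) * sampleMean (x j) k : ℝ) : EReal))
        atTop (𝓝 (d k))) →
      Tendsto (fun j => condRejection (R (N j)) α (x j)) atTop (𝓝 ℓ)) :
    Tendsto (fun n => rejectionProb (P n) (R n) α) atTop (𝓝 ℓ) := by
  simp only [rejectionProb_eq hα₀ hα₁]
  refine tendsto_integral_of_tendsto_inf_principal
    (f := fun p : Σ n, Sample n m => condRejection (R p.1) α p.2)
    (probFilter_le_sampleFilter hP hS hRn hd) hP.moment hℓ
    (fun p => ⟨measureReal_nonneg, measureReal_le_one⟩)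
    (fun n => measurable_condRejection (R := R n) hα₀ hα₁) fun M => ?_
  -- The moment is only bounded in probability, so M stays fixed: a sequence along the filter
  -- restricted to moments at most M is a regular array.
  refine tendsto_of_seq_tendsto fun u hu => ?_
  obtain ⟨hu1, hu2⟩ := tendsto_inf.1 hu
  obtain ⟨⟨hN, hV⟩, hD⟩ := tendsto_sampleFilter_iff.1 hu1
  refine h M (fun j => (u j).1) (fun j => (u j).2) ⟨hN, hV, ?_⟩ (hR.comp hN)
    (hRn.comp hN) hD
  filter_upwards [tendsto_principal.1 hu2] with j hj
  exact (le_abs_self _).trans hj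

end SampleFilter

end ResampledTest
end

/-! ### The three regimes of the scaled means -/

open ResampledTest
theorem lemma1 {m : ℕ} (hm : 0 < m) (α : ℝ) (hα₀ : 0 < α) (hα₁ : α < 1)
    (R : ℕ → ℕ) (hR₂ : ∀ n, 2 ≤ R n) (hR : Tendsto R atTop atTop)
    (hRn : Tendsto (fun n : ℕ => Real.sqrt (R n) / (n : ℝ)) atTop (𝓝 0))
    (𝒟₀ : ∀ n, Set (DGP n m)) (h𝒟₀ : RegularClass 𝒟₀)
    (P : ∀ n, DGP n m) (hP : ∀ n, P n ∈ 𝒟₀ n)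
    (δstar : Fin m → EReal)
    (hδ : ∀ k, Tendsto (fun n => (((R n : ℝ) ^ (1 / 4 : ℝ) * (P n).mean k : ℝ) : EReal))
      atTop (𝓝 (δstar k))) :
    ((⨆ k, δstar k) ≤ 0 →
      Tendsto (fun n => rejectionProb (P n) (R n) α) atTop (𝓝 α)) ∧
    ((⨆ k, δstar k) = ⊤ →
      Tendsto (fun n => rejectionProb (P n) (R n) α) atTop (𝓝 1)) ∧
    (0 < (⨆ k, δstar k) ∧ (⨆ k, δstar k) < ⊤ →
      ∃ β : ℝ, α < β ∧ Tendsto (fun n => rejectionProb (P n) (R n) α) atTop (𝓝 β)) := by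
  have : Nonempty (Fin m) := ⟨⟨0, hm⟩⟩
  obtain ⟨δ, L, U, hδ₀, hL, -, hreg⟩ := h𝒟₀
  have hseq := hreg P hP
  obtain ⟨S, hSconv, -, hSh, hSe⟩ := hseq.variance
  have hS : S.PosDef := hSh.posDef_iff_eigenvalues_pos.2 fun k => hL.trans (hSe k)
  obtain ⟨q, hq⟩ := exists_limitCdf_const_eq hm hS (p := 1 - α) (by linarith) (by linarith)
  -- One limit formula serves both (a) and (c); in (a) all limiting shifts vanish and it reduces to
  -- 1 - (1 - α).
  have hfinite : (⨆ k, δstar k) < ⊤ → Tendsto (fun n => rejectionProb (P n) (R n) α) atTop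
      (𝓝 (1 - limitCdf S fun k => q - limitShift S δstar k)) := by
    intro htop
    refine tendsto_rejectionProb hα₀ hα₁ hseq hSconv hR hRn hδ ?_ fun M N x hx hRN hRNn hd =>
      hx.tendsto_condRejection hm hα₀ hα₁ hδ₀ hS hRN hRNn hd
        (fun k => ((le_iSup δstar k).trans_lt htop).ne) hq
    exact ⟨sub_nonneg.2 measureReal_le_one, sub_le_self _ measureReal_nonneg⟩
  refine ⟨fun h => ?_, fun h => ?_, fun h => ?_⟩
  · have h1 := hfinite (h.trans_lt EReal.zero_lt_top)
    have h2 : ∀ k, limitShift S δstar k = 0 := by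
      intro k
      simp [limitShift, max_eq_right ((le_iSup δstar k).trans h)]
    simpa [h2, hq] using h1
  -- With finitely many components the supremum is attained, so one scaled mean diverges.
  · obtain ⟨k, hk⟩ := exists_eq_ciSup_of_finite (f := δstar)
    refine tendsto_rejectionProb hα₀ hα₁ hseq hSconv hR hRn hδ (by simp)
      fun M N x hx hRN hRNn hd =>
        hx.tendsto_condRejection_one hm hα₀ hα₁ hδ₀ hS hRN hRNn (k := k) ?_
    have := hd k
    rw [hk, h] at this
    exact EReal.tendsto_coe_nhds_top_iff.1 this
  · refine ⟨_, ?_, hfinite h.2⟩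
    obtain ⟨k, hk⟩ := lt_iSup_iff.1 h.1
    have hshift : ∀ l, 0 ≤ limitShift S δstar l := by
      intro l
      have := hS.diag_pos (i := l)
      unfold limitShift; positivity
    have hpos : 0 < limitShift S δstar k := by
      have h1 := hS.diag_pos (i := k)
      have h2 : (0 : ℝ) < (max (δstar k) 0).toReal := by
        rw [max_eq_left hk.le]
        exact EReal.toReal_pos hk ((le_iSup δstar k).trans_lt h.2).ne
      unfold limitShift; positivity
    -- Nonnegative shifts, one of them positive, strictly lower G below 1 - α.
    have := limitCdf_lt hm hS (a := fun k => q - limitShift S δstar k) (b := fun _ => q)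
      (Pi.lt_def.2 ⟨fun l => sub_le_self _ (hshift l), k, sub_lt_self _ hpos⟩)
    linarith
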